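/- A coloured graph is a finite simple graph $G=(V,E)$ with a colouring $\omega:V\to C$ (not necessarily proper), where $C$ is a finite set of colours. A move $(v,d)$ with $v\in V$, $d\in C$ gives colour $d$ to all vertices of the monochromatic component containing $v$ (the component of $v$ in the graph formed by the edges of $G$ whose two ends currently have the same colour). Let $m_G(G,\omega,d)$ be the minimum length of a sequence of moves after which every vertex of $G$ has colour $d$, and let $m_G(G,\omega)=\min_{d\in C}m_G(G,\omega,d)$. By a connected subgraph of $G$ we mean a connected induced subgraph, that is, a nonempty vertex set that induces a connected subgraph of $G$. Theorem. There is an algorithm which, given a connected graph $G$ with a colouring $\omega$ from colour-set $C$, computes $m_G(G,\omega,d)$ for every $d\in C$, and hence also $m_G(G,\omega)$, in time $O(|C|^3\cdot N^3)$ whenever $G$ has at most $N$ connected subgraphs. (The value of $N$ is not part of the input, and the implied constant is absolute.) Here the algorithm is a single program for a word RAM. The input consists of $|V|$, $|C|$, the list of colours of the vertices and the adjacency matrix of $G$, with vertices and colours numbered from $0$; all other memory is initially $0$. Each assignment of a constant, addition, truncated subtraction, multiplication, memory access and comparison of two registers takes one step, and every number written during the computation is bounded by a fixed polynomial in $|C|\cdot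 N$, that is, words have $O(1+\log(|C|\,N))$ bits. -/

import Mathlib

namespace FloodIt

/-! ### The game -/

section Game

variable {V C : Type*}

/-- The edges of `G` whose two ends have the same colour under `ω`; its connected components are the
monochromatic components of `G`. -/
def monoGraph (G : SimpleGraph V) (ω : V → C) : SimpleGraph V where
  Adj u v := G.Adj u v ∧ ω u = ω v
  symm := ⟨fun _ _ h => ⟨h.1.symm, h.2.symm⟩⟩
  loopless := ⟨fun _ h => h.1.ne rfl⟩

/-- The vertex set of the monochromatic component of `v`. -/
def comp (G : SimpleGraph V) (ω : V → C) (v : V) : Set V :=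
  {u | (monoGraph G ω).Reachable v u}

open Classical in
/-- The colouring after the move `m = (v, d)`: the whole monochromatic component of `v` gets
colour `d`. -/
noncomputable def play (G : SimpleGraph V) (ω : V → C) (m : V × C) : V → C :=
  fun u => if u ∈ comp G ω m.1 then m.2 else ω u

/-- The colouring after a sequence of moves, played from left to right. -/
noncomputable def playSeq (G : SimpleGraph V) (ω : V → C) (S : List (V × C)) : V → C :=
  S.foldl (play G) ω

/-- The minimum number of moves that give every vertex of `G` the colour `d`
(it is `⊤` if no sequence of moves does). -/
noncomputable def minMovesTo (G : SimpleGraph V) (ω : V → C) (d : C) : ℕ∞ :=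
  ⨅ (S : List (V × C)) (_ : ∀ v, playSeq G ω S v = d), (S.length : ℕ∞)

/-- The minimum number of moves that make `G` monochromatic. -/
noncomputable def minMoves (G : SimpleGraph V) (ω : V → C) : ℕ∞ :=
  ⨅ d : C, minMovesTo G ω d

/-- The number of connected (induced) subgraphs of `G`, that is, of nonempty vertex sets that induce
a connected subgraph. -/
noncomputable def numConnected (G : SimpleGraph V) : ℕ :=
  {A : Set V | (G.induce A).Connected}.ncard

end Game

/-! ### Word RAM programs with their running time -/

/-- A configuration of the machine: registers, and a random-access memory. A program mentions only
finitely many registers. -/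
structure State where
  reg : ℕ → ℕ
  mem : ℕ → ℕ

/-- The elementary instructions; letters `r`, `a`, `b` are numbers of registers. -/
inductive Instr where
  /-- `r := k` for a constant `k` -/
  | const (r k : ℕ)
  /-- `r := a + b` -/
  | add (r a b : ℕ)
  /-- `r := max (a - b) 0` -/
  | sub (r a b : ℕ)
  /-- `r := a * b` -/
  | mul (r a b : ℕ)
  /-- `r := mem[a]` -/
  | load (r a : ℕ)
  /-- `mem[a] := b` -/
  | store (a b : ℕ)

/-- The number that an instruction writes. -/
def Instr.value (s : State) : Instr → ℕ
  | .const _ k => k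
  | .add _ a b => s.reg a + s.reg b
  | .sub _ a b => s.reg a - s.reg b
  | .mul _ a b => s.reg a * s.reg b
  | .load _ a => s.mem (s.reg a)
  | .store _ b => s.reg b

/-- The configuration after an instruction. -/
def Instr.exec (i : Instr) (s : State) : State :=
  match i with
  | .const r _ | .add r _ _ | .sub r _ _ | .mul r _ _ | .load r _ =>
    { s with reg := Function.update s.reg r (i.value s) }
  | .store a _ => { s with mem := Function.update s.mem (s.reg a) (i.value s) }

/-- Tests comparing the contents of two registers. -/
inductive Test where
  /-- `a < b` -/
  | lt (a b : ℕ)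
  /-- `a = b` -/
  | eq (a b : ℕ)

/-- The outcome of a test. -/
def Test.Holds (s : State) : Test → Prop
  | .lt a b => s.reg a < s.reg b
  | .eq a b => s.reg a = s.reg b

/-- Programs. -/
inductive Prog where
  | skip
  | instr (i : Instr)
  | seq (p q : Prog)
  | ite (b : Test) (p q : Prog)
  | loop (b : Test) (p : Prog)

/-- `Exec W p s s' t`: started in `s`, the program `p` halts in `s'` after `t` steps, and no number
written on the way exceeds `W`. Every instruction and every evaluation of a test is one step;
`loop b p` repeats `p` while `b` holds. -/
inductive Exec (W : ℕ) : Prog → State → State → ℕ → Prop where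
  | skip (s : State) : Exec W .skip s s 1
  | instr (i : Instr) (s : State) (h : i.value s ≤ W) : Exec W (.instr i) s (i.exec s) 1
  | seq {p q : Prog} {s s₁ s₂ : State} {t₁ t₂ : ℕ} (h₁ : Exec W p s s₁ t₁)
      (h₂ : Exec W q s₁ s₂ t₂) : Exec W (.seq p q) s s₂ (t₁ + t₂)
  | ite_true {b : Test} {p q : Prog} {s s₁ : State} {t : ℕ} (hb : b.Holds s)
      (h : Exec W p s s₁ t) : Exec W (.ite b p q) s s₁ (t + 1)
  | ite_false {b : Test} {p q : Prog} {s s₁ : State} {t : ℕ} (hb : ¬ b.Holds s)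
      (h : Exec W q s s₁ t) : Exec W (.ite b p q) s s₁ (t + 1)
  | loop_false {b : Test} {p : Prog} {s : State} (hb : ¬ b.Holds s) : Exec W (.loop b p) s s 1
  | loop_true {b : Test} {p : Prog} {s s₁ s₂ : State} {t₁ t₂ : ℕ} (hb : b.Holds s)
      (h₁ : Exec W p s s₁ t₁) (h₂ : Exec W (.loop b p) s₁ s₂ t₂) :
      Exec W (.loop b p) s s₂ (t₁ + t₂ + 1)

open Classical in
/-- The input: a coloured graph with vertices `0, …, n - 1` and colours `0, …, c - 1`. Registers `0`
and `1` hold `n` and `c`, the first `n` memory cells hold the colours of the vertices, the next `n ^ 2`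
cells the adjacency matrix, row by row. All other registers and cells hold `0`. -/
noncomputable def inputState {n c : ℕ} (G : SimpleGraph (Fin n)) (ω : Fin n → Fin c) : State where
  reg := fun r => if r = 0 then n else if r = 1 then c else 0
  mem := fun a =>
    if h : a < n then (ω ⟨a, h⟩ : ℕ)
    else if ∃ u v : Fin n, a = n + n * (u : ℕ) + (v : ℕ) ∧ G.Adj u v then 1
    else 0

end FloodIt

/-! The game is replaced by a calculus of trees. A derivation `Der` builds a vertex set from small
monochromatic pieces: recolouring the set built so far costs one, and merging two disjoint adjacent
sets of the same colour is free. On a connected graph, `k` moves can give every vertex colour `d`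
exactly when the whole vertex set has a derivation of cost `k` from its single vertices
(`exists_playSeq_iff`). Unlike a sequence of moves, a derivation splits into independent derivations
of two smaller connected sets, so its least cost obeys a recursion over connected sets.

The bridge is `Der.coarsen`: starting from larger pieces, each still of one colour, never costs
more. It rests on `Der.glue`, which combines two derivations overlapping in a single piece. In one
direction (`Der.of_play`), a derivation that is possible after a move is rearranged so that the
component just recoloured is one piece, and the move becomes one recolouring of that piece. In the
other (`Der.exists_move`), a derivation is rearranged to start from the monochromatic components.
Adjacent components differ in colour, so unless nothing has to be done some recolouring is applied
directly to a component, and this is a genuine move.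

The algorithm lists all connected sets by a breadth-first search in order of size, tabulates the
sizes of their pairwise intersections, and fills a table of costs per set and colour by trying all
pairs of sets that partition the given one (`cost_le_of_der`, `der_cost`). This table takes order `c
^ 2 * N ^ 3` steps. The search takes order `n ^ 2 * N ^ 2`, which is of order `N ^ 3` because a
connected graph on `n` vertices has at least `n * (n + 1) / 2` connected sets
(`sq_le_numConnected`).

The program is written in a small structured language. Its compilation to the word RAM is verified
once and for all (`Ex.exec` and the `Tri` rules), with running time and number size bounded by
recursion on the syntax. -/

namespace FloodIt

/-! ### Derivations -/

section Derivation

variable {V C : Type*} {G : SimpleGraph V} {q : V → V} {ω : V → C}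

/-- `Der G q ω A d k`: the set `A` can be given colour `d` at cost `k` by recolouring (at cost one) and
merging disjoint adjacent sets, starting from the fibres of `q`, coloured by `ω`. -/
inductive Der (G : SimpleGraph V) (q : V → V) (ω : V → C) : Set V → C → ℕ → Prop
  | leaf (v : V) : Der G q ω {x | q x = q v} (ω v) 0
  | recol {A : Set V} {d : C} {k : ℕ} (d' : C) (h : Der G q ω A d k) : Der G q ω A d' (k + 1)
  | merge {A B : Set V} {d : C} {k l : ℕ} (hA : Der G q ω A d k) (hB : Der G q ω B d l)
      (hd : Disjoint A B) (he : ∃ a ∈ A, ∃ b ∈ B, G.Adj a b) : Der G q ω (A ∪ B) d (k + l)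

theorem Der.saturated {A : Set V} {d : C} {k : ℕ} (h : Der G q ω A d k) {x y : V} (hx : x ∈ A)
    (hxy : q y = q x) : y ∈ A := by
  induction h with
  | leaf v => exact hxy.trans hx
  | recol _ _ ih => exact ih hx
  | merge _ _ _ _ ih₁ ih₂ => exact hx.imp ih₁ ih₂

/-- The fibre of `w` is a leaf in the derivation of `A`. Since `B` is available in the colour of
that leaf, its derivation can be grafted there; everything else in `A` is disjoint from `B`, so all
later merges stay legitimate. -/
theorem Der.subst (hq : ∀ x y, q x = q y → ω x = ω y) {A B : Set V} {d : C} {k l : ℕ} {w : V}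
    (h : Der G q ω A d k) (hB : Der G q ω B (ω w) l) (hAB : A ∩ B = {x | q x = q w}) :
    Der G q ω (A ∪ B) d (k + l) := by
  induction h with
  | leaf v =>
    have hw : w ∈ {x | q x = q v} ∩ B := hAB ▸ rfl
    have hv : q w = q v := hw.1
    have hsub : {x | q x = q v} ⊆ B := fun x hx => hB.saturated hw.2 (hx.trans hv.symm)
    rw [Set.union_eq_self_of_subset_left hsub, ← hq _ _ hv, zero_add]
    exact hB
  | recol d' _ ih => rw [add_right_comm]; exact (ih hAB).recol d'
  | @merge A₁ A₂ d k₁ k₂ h₁ h₂ hd he ih₁ ih₂ =>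
    have key : ∀ {P Q : Set V} {i j : ℕ}, Der G q ω P d i → Der G q ω Q d j → Disjoint P Q →
        (∃ a ∈ P, ∃ b ∈ Q, G.Adj a b) → (P ∪ Q) ∩ B = {x | q x = q w} → w ∈ P →
        (P ∩ B = {x | q x = q w} → Der G q ω (P ∪ B) d (i + l)) →
        Der G q ω (P ∪ Q ∪ B) d (i + j + l) := by
      intro P Q i j hP hQ hPQ he hPB hwP ih
      have hW : ∀ x, q x = q w → x ∈ P := fun x hx => hP.saturated hwP hx
      have h1 : P ∩ B = {x | q x = q w} := by
        ext x
        have := Set.ext_iff.1 hPB x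
        simp only [Set.mem_inter_iff, Set.mem_union, Set.mem_ofPred_eq] at this ⊢
        constructor
        · intro hx; exact this.1 ⟨Or.inl hx.1, hx.2⟩
        · intro hx; exact ⟨hW x hx, (this.2 hx).2⟩
      have h2 : Disjoint (P ∪ B) Q := by
        rw [Set.disjoint_union_left]
        refine ⟨hPQ, Set.disjoint_left.2 fun x hx hxQ => ?_⟩
        have : x ∈ {x | q x = q w} := hPB ▸ ⟨Or.inr hxQ, hx⟩
        exact Set.disjoint_left.1 hPQ (hW x this) hxQ
      obtain ⟨a, ha, b, hb, hab⟩ := he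
      have := (ih h1).merge hQ h2 ⟨a, Or.inl ha, b, hb, hab⟩
      rwa [Set.union_right_comm, add_right_comm] at this
    have hw : w ∈ (A₁ ∪ A₂) ∩ B := hAB ▸ rfl
    rcases hw.1 with hw | hw
    · exact key h₁ h₂ hd he hAB hw ih₁
    · rw [Set.union_comm A₁, add_comm k₁]
      obtain ⟨a, ha, b, hb, hab⟩ := he
      exact key h₂ h₁ hd.symm ⟨b, hb, a, ha, hab.symm⟩ (Set.union_comm A₁ A₂ ▸ hAB) hw ih₂

/-- Follow the part of the derivation of `B` that contains `w`. As long as it has the colour `ω w`,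
it can itself be grafted into the derivation of `A` by `Der.subst`. This is done just before its
first recolouring, which then hides the final colour of `A`; without such a recolouring it is done
at the end, where `d = ω w`. -/
theorem Der.glue (hq : ∀ x y, q x = q y → ω x = ω y) {A B : Set V} {d : C} {k l : ℕ} {w : V}
    (hA : Der G q ω A d k) (hB : Der G q ω B d l) (hAB : A ∩ B = {x | q x = q w}) :
    Der G q ω (A ∪ B) d (k + l) := by
  suffices H : ∀ {B : Set V} {d' : C} {l : ℕ}, Der G q ω B d' l → A ∩ B = {x | q x = q w} →
      d' = ω w ∨ Der G q ω (A ∪ B) d' (k + l) by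
    rcases H hB hAB with h | h
    · exact hA.subst hq (h ▸ hB) hAB
    · exact h
  clear hAB hB
  intro B d' l hB hAB
  induction hB with
  | leaf v =>
    have hw : w ∈ A ∩ {x | q x = q v} := hAB ▸ rfl
    exact Or.inl (hq _ _ hw.2).symm
  | @recol B d₁ l d₂ h ih =>
    right
    rcases ih hAB with h' | h'
    · exact (hA.subst hq (h' ▸ h) hAB).recol d₂
    · exact h'.recol d₂
  | @merge B₁ B₂ d k₁ k₂ h₁ h₂ hd he ih₁ ih₂ =>
    have key : ∀ {P Q : Set V} {i j : ℕ}, Der G q ω P d i → Der G q ω Q d j → Disjoint P Q →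
        (∃ a ∈ P, ∃ b ∈ Q, G.Adj a b) → A ∩ (P ∪ Q) = {x | q x = q w} → w ∈ P →
        (A ∩ P = {x | q x = q w} → d = ω w ∨ Der G q ω (A ∪ P) d (k + i)) →
        d = ω w ∨ Der G q ω (A ∪ (P ∪ Q)) d (k + (i + j)) := by
      intro P Q i j hP hQ hPQ he hPB hwP ih
      have hW : ∀ x, q x = q w → x ∈ P := fun x hx => hP.saturated hwP hx
      have h1 : A ∩ P = {x | q x = q w} := by
        ext x
        have := Set.ext_iff.1 hPB x
        simp only [Set.mem_inter_iff, Set.mem_union, Set.mem_ofPred_eq] at this ⊢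
        constructor
        · intro hx; exact this.1 ⟨hx.1, Or.inl hx.2⟩
        · intro hx; exact ⟨(this.2 hx).1, hW x hx⟩
      have h2 : Disjoint (A ∪ P) Q := by
        rw [Set.disjoint_union_left]
        refine ⟨Set.disjoint_left.2 fun x hx hxQ => ?_, hPQ⟩
        have : x ∈ {x | q x = q w} := hPB ▸ ⟨hx, Or.inr hxQ⟩
        exact Set.disjoint_left.1 hPQ (hW x this) hxQ
      rcases ih h1 with ih | ih
      · exact Or.inl ih
      · obtain ⟨a, ha, b, hb, hab⟩ := he
        rw [← Set.union_assoc, ← add_assoc]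
        exact Or.inr (ih.merge hQ h2 ⟨a, Or.inr ha, b, hb, hab⟩)
    have hw : w ∈ A ∩ (B₁ ∪ B₂) := hAB ▸ rfl
    rcases hw.2 with hw | hw
    · exact key h₁ h₂ hd he hAB hw ih₁
    · rw [Set.union_comm B₁, add_comm k₁]
      obtain ⟨a, ha, b, hb, hab⟩ := he
      exact key h₂ h₁ hd.symm ⟨b, hb, a, ha, hab.symm⟩ (Set.union_comm B₁ B₂ ▸ hAB) hw ih₂

/-- Two fibres of the same colour may be joined. -/
theorem Der.join [DecidableEq V] (hq : ∀ x y, q x = q y → ω x = ω y) {u v : V} (huv : ω u = ω v)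
    {A : Set V} {d : C} {k : ℕ} (h : Der G q ω A d k) :
    Der G (fun x => if q x = q u then q v else q x) ω
      {x | ∃ y ∈ A, (if q y = q u then q v else q y) = if q x = q u then q v else q x} d k := by
  set q' : V → V := fun x => if q x = q u then q v else q x with hq'
  have hq'ω : ∀ x y, q' x = q' y → ω x = ω y := by
    intro x y hxy
    simp only [hq'] at hxy
    split_ifs at hxy with h1 h2 h2
    · exact hq _ _ (h1.trans h2.symm)
    · exact (hq _ _ h1).trans (huv.trans (hq _ _ hxy))
    · exact (hq _ _ hxy).trans (huv.symm.trans (hq _ _ h2).symm)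
    · exact hq _ _ hxy
  have hqq' : ∀ x y, q x = q y → q' x = q' y := fun x y hxy => by simp only [hq', hxy]
  have hv : q' v = q v := by simp only [hq']; split_ifs <;> rfl
  change Der G q' ω {x | ∃ y ∈ A, q' y = q' x} d k
  induction h with
  | leaf w =>
    have : {x | ∃ y ∈ {x | q x = q w}, q' y = q' x} = {x | q' x = q' w} := by
      ext x
      constructor
      · rintro ⟨y, hy, hyx⟩; exact hyx.symm.trans (hqq' _ _ hy)
      · intro hx; exact ⟨w, rfl, hx.symm⟩
    rw [this]
    exact .leaf w
  | recol d' _ ih => exact ih.recol d'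
  | @merge A B d k l hA hB hd he ihA ihB =>
    have hun : {x | ∃ y ∈ A ∪ B, q' y = q' x} =
        {x | ∃ y ∈ A, q' y = q' x} ∪ {x | ∃ y ∈ B, q' y = q' x} := by
      ext x; simp [or_and_right, exists_or]
    rw [hun]
    -- `A` and `B` are disjoint unions of old fibres, so their saturations can meet only if one
    -- contains the fibre of `u` and the other that of `v`. Then they meet in exactly the joined
    -- fibre, the situation of `Der.glue`.
    by_cases hdis : Disjoint {x | ∃ y ∈ A, q' y = q' x} {x | ∃ y ∈ B, q' y = q' x}
    · obtain ⟨a, ha, b, hb, hab⟩ := he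
      exact ihA.merge ihB hdis ⟨a, ⟨a, ha, rfl⟩, b, ⟨b, hb, rfl⟩, hab⟩
    · have hz : ∀ z, (∃ y ∈ A, q' y = q' z) → (∃ y ∈ B, q' y = q' z) → q' z = q' v := by
        rintro z ⟨a, ha, haz⟩ ⟨b, hb, hbz⟩
        have hne : q a ≠ q b := fun hab =>
          Set.disjoint_left.1 hd (hA.saturated ha hab.symm) hb
        have hab := haz.trans hbz.symm
        rw [hv, ← haz]
        by_cases h1 : q a = q u
        · simp only [hq', if_pos h1]
        · by_cases h2 : q b = q u
          · rw [hab]; simp only [hq', if_pos h2]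
          · simp only [hq', if_neg h1, if_neg h2] at hab
            exact absurd hab hne
      obtain ⟨z, hzA, hzB⟩ := Set.not_disjoint_iff.1 hdis
      have hzv := hz z hzA hzB
      refine ihA.glue hq'ω ihB (w := v) ?_
      ext x
      constructor
      · rintro ⟨hxA, hxB⟩; exact hz x hxA hxB
      · intro hx
        have hxz : q' z = q' x := hzv.trans (Eq.symm hx)
        obtain ⟨a, ha, haz⟩ := hzA
        obtain ⟨b, hb, hbz⟩ := hzB
        exact ⟨⟨a, ha, haz.trans hxz⟩, ⟨b, hb, hbz.trans hxz⟩⟩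

/-- Starting from larger monochromatic sets does not increase the cost. -/
theorem Der.coarsen [Fintype V] (R : Setoid V) (hR : ∀ x y, R x y → ω x = ω y) {d : C} {k : ℕ}
    (hqR : ∀ x y, q x = q y → R x y) (h : Der G q ω Set.univ d k) :
    ∃ q' : V → V, (∀ x y, q' x = q' y ↔ R x y) ∧ Der G q' ω Set.univ d k := by
  classical
  -- Each joining of two fibres within a class of `R` lowers the number of fibres.
  induction hm : (Finset.univ.image q).card using Nat.strong_induction_on generalizing q with
  | _ m ih =>
    by_cases hall : ∀ x y, R x y → q x = q y
    · exact ⟨q, fun x y => ⟨hqR x y, hall x y⟩, h⟩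
    · push Not at hall
      obtain ⟨u, v, huv, hne⟩ := hall
      have hj := h.join (fun x y hxy => hR _ _ (hqR x y hxy)) (hR _ _ huv)
      refine ih _ ?_ (q := fun x => if q x = q u then q v else q x) ?_ ?_ rfl
      · rw [← hm]
        refine Finset.card_lt_card (Finset.ssubset_iff_of_subset ?_ |>.2 ⟨q u, ?_, ?_⟩)
        · intro y hy
          simp only [Finset.mem_image, Finset.mem_univ, true_and] at hy ⊢
          obtain ⟨x, rfl⟩ := hy
          split_ifs
          · exact ⟨v, rfl⟩
          · exact ⟨x, rfl⟩
        · simp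
        · simp only [Finset.mem_image, Finset.mem_univ, true_and, not_exists]
          intro x
          split_ifs with h1
          · exact fun h => hne h.symm
          · exact h1
      · intro x y hxy
        split_ifs at hxy with h1 h2 h2
        · exact hqR _ _ (h1.trans h2.symm)
        · exact R.trans (R.trans (hqR _ _ h1) huv) (hqR _ _ hxy)
        · exact R.trans (hqR _ _ hxy) (R.trans (R.symm huv) (R.symm (hqR _ _ h2)))
        · exact hqR _ _ hxy
      · convert hj using 1
        ext x
        simp only [Set.mem_univ, true_and, Set.mem_ofPred_eq, true_iff]
        exact ⟨x, rfl⟩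

end Derivation

/-! ### Connected sets -/

section Connected

variable {V C : Type*} {G : SimpleGraph V}

theorem connected_singleton (v : V) : (G.induce {v}).Connected := by
  rw [SimpleGraph.induce_singleton_eq_top]
  have : Nonempty ({v} : Set V) := ⟨⟨v, rfl⟩⟩
  exact SimpleGraph.Connected.of_subsingleton

theorem connected_insert {B : Set V} {a b : V} (hB : (G.induce B).Connected) (hb : b ∈ B)
    (hab : G.Adj b a) : (G.induce (insert a B)).Connected := by
  rw [Set.insert_eq, Set.union_comm]
  exact SimpleGraph.connected_induce_union hB.preconnected (connected_singleton a).preconnected hb rfl hab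

theorem exists_adj_of_ssubset {A B : Set V} (hA : (G.induce A).Connected) (hB : B.Nonempty)
    (hBA : B ⊆ A) (hne : B ≠ A) : ∃ b ∈ B, ∃ a ∈ A, a ∉ B ∧ G.Adj b a := by
  obtain ⟨b, hb⟩ := hB
  obtain ⟨a, ha, haB⟩ := Set.exists_of_ssubset (hBA.ssubset_of_ne hne)
  obtain ⟨p⟩ := hA.preconnected ⟨b, hBA hb⟩ ⟨a, ha⟩
  obtain ⟨⟨⟨x, y⟩, hxy⟩, -, hx, hy⟩ := p.exists_boundary_dart {z | (z : V) ∈ B} hb haB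
  exact ⟨x, hx, y, y.2, hy, hxy⟩

/-- A connected set is reached from any of its singletons by adding adjacent vertices. -/
theorem connected_induction [Finite V] {A : Set V} (hA : (G.induce A).Connected) {P : Set V → Prop}
    {v : V} (hv : v ∈ A) (h0 : P {v})
    (hstep : ∀ B ⊆ A, (G.induce B).Connected → v ∈ B → P B → ∀ b ∈ B, ∀ a ∈ A, a ∉ B → G.Adj b a →
      P (insert a B)) : P A := by
  have H : ∀ m, ∀ B ⊆ A, (G.induce B).Connected → v ∈ B → P B → (A \ B).ncard = m → P A := by
    intro m
    induction m with
    | zero =>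
      intro B hBA _ _ hP hm
      rw [Set.ncard_eq_zero (Set.toFinite _), Set.sdiff_eq_empty] at hm
      rwa [← hBA.antisymm hm]
    | succ m ih =>
      intro B hBA hBc hvB hP hm
      have hne : B ≠ A := by rintro rfl; simp at hm
      obtain ⟨b, hb, a, ha, haB, hab⟩ := exists_adj_of_ssubset hA ⟨v, hvB⟩ hBA hne
      refine ih (insert a B) (Set.insert_subset ha hBA) (connected_insert hBc hb hab)
        (Set.mem_insert_of_mem _ hvB) (hstep B hBA hBc hvB hP b hb a ha haB hab) ?_
      have : A \ insert a B = (A \ B) \ {a} := by ext x; simp; tauto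
      rw [this, Set.ncard_sdiff_singleton_of_mem (Set.mem_sdiff_of_mem ha haB), hm]
      rfl
  exact H _ {v} (Set.singleton_subset_iff.2 hv) (connected_singleton v) rfl h0 rfl

theorem leaf_id (ω : V → C) (v : V) : Der G id ω {v} (ω v) 0 := by
  simpa using Der.leaf (G := G) (q := id) (ω := ω) v

theorem Der.of_mono [Finite V] {ω : V → C} {A : Set V} (hA : (G.induce A).Connected) {d : C}
    (hd : ∀ x ∈ A, ω x = d) : Der G id ω A d 0 := by
  obtain ⟨⟨v, hv⟩⟩ := hA.nonempty
  refine connected_induction hA (P := fun B => Der G id ω B d 0) hv (hd v hv ▸ leaf_id ω v) ?_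
  intro B _ _ _ hP b hb a ha haB hab
  rw [Set.insert_eq, Set.union_comm]
  exact hP.merge (hd a ha ▸ leaf_id ω a) (Set.disjoint_singleton_right.2 haB) ⟨b, hb, a, rfl, hab⟩

/-- Recolouring vertex by vertex. -/
theorem Der.of_connected [Fintype V] [DecidableEq C] {ω : V → C} {A : Set V} [DecidablePred (· ∈ A)]
    (hA : (G.induce A).Connected) (d : C) :
    Der G id ω A d ({v | v ∈ A ∧ ω v ≠ d} : Finset V).card := by
  classical
  obtain ⟨⟨v, hv⟩⟩ := hA.nonempty
  have hsing : ∀ v, Der G id ω {v} d (if ω v ≠ d then 1 else 0) := by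
    intro v
    split_ifs with h
    · exact (leaf_id ω v).recol d
    · rw [not_not] at h; exact h ▸ leaf_id ω v
  have := connected_induction hA
    (P := fun B => Der G id ω B d (∑ v, if v ∈ B ∧ ω v ≠ d then 1 else 0)) hv ?_ ?_
  · rw [Finset.card_filter]
    convert this
  · convert hsing v using 1
    rw [Finset.sum_eq_single v]
    · simp
    · intro x _ hx; simp [hx]
    · simp
  · intro B _ _ _ hP b hb a ha haB hab
    rw [Set.insert_eq, Set.union_comm]
    convert hP.merge (hsing a) (Set.disjoint_singleton_right.2 haB) ⟨b, hb, a, rfl, hab⟩ using 1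
    have : (if ω a ≠ d then 1 else 0) = ∑ v, if v = a ∧ ω v ≠ d then 1 else 0 := by
      rw [Finset.sum_eq_single a]
      · simp
      · intro x _ hx; simp [hx]
      · simp
    rw [this, ← Finset.sum_add_distrib]
    refine Finset.sum_congr rfl fun x _ => ?_
    by_cases hx : x = a
    · subst hx; simp [haB]
    · simp [hx]

theorem Der.connected {ω : V → C} {A : Set V} {d : C} {k : ℕ} (h : Der G id ω A d k) :
    (G.induce A).Connected := by
  induction h with
  | leaf v => simp
  | recol _ _ ih => exact ih
  | merge _ _ _ he ih₁ ih₂ =>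
    obtain ⟨a, ha, b, hb, hab⟩ := he
    exact SimpleGraph.connected_induce_union ih₁.preconnected ih₂.preconnected ha hb hab

end Connected

/-! ### Derivations and moves -/

section Moves

variable {V C : Type*} {G : SimpleGraph V} {ω : V → C}

theorem eq_of_mem_comp {u v : V} (h : u ∈ comp G ω v) : ω v = ω u := by
  obtain ⟨p⟩ := h
  induction p with
  | nil => rfl
  | cons h _ ih => exact h.2.trans ih

theorem connected_comp (v : V) : (G.induce (comp G ω v)).Connected := by
  have h := ((monoGraph G ω).connectedComponentMk v).maximal_connected_induce_supp.1
  have hs : ((monoGraph G ω).connectedComponentMk v).supp = comp G ω v := by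
    ext u
    simp only [SimpleGraph.ConnectedComponent.mem_supp_iff, SimpleGraph.ConnectedComponent.eq]
    exact ⟨fun h => h.symm, fun h => h.symm⟩
  rw [hs] at h
  refine h.mono ?_
  intro a b hab
  exact hab.1

theorem play_of_mem {v u : V} {d : C} (h : u ∈ comp G ω v) : play G ω (v, d) u = d := by
  simp [play, h]

theorem play_of_notMem {v u : V} {d : C} (h : u ∉ comp G ω v) : play G ω (v, d) u = ω u := by
  simp [play, h]

/-- Refining monochromatic connected fibres to single vertices. -/
theorem Der.refine [Finite V] {q : V → V} {ω' : V → C} (hq : ∀ x y, q x = q y → ω x = ω y)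
    (hc : ∀ v, (G.induce {x | q x = q v}).Connected) {A : Set V} {d : C} {k : ℕ}
    (h : Der G q ω A d k) (hω : ∀ x ∈ A, ω' x = ω x) : Der G id ω' A d k := by
  induction h with
  | leaf v => exact .of_mono (hc v) fun x hx => (hω x hx).trans (hq _ _ hx)
  | recol d' _ ih => exact (ih hω).recol d'
  | merge _ _ hd he ih₁ ih₂ =>
    exact (ih₁ fun x hx => hω x (Or.inl hx)).merge (ih₂ fun x hx => hω x (Or.inr hx)) hd he

/-- After coarsening, the component that was recoloured is a single leaf. Under the old colouring
this leaf is obtained by one recolouring, and all other leaves are unchanged single vertices. The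
leaves are disjoint, so only the branch containing `v` pays the extra one. -/
theorem Der.of_play [Fintype V] {m : V × C} {d : C} {k : ℕ}
    (h : Der G id (play G ω m) Set.univ d k) : Der G id ω Set.univ d (k + 1) := by
  obtain ⟨v, e⟩ := m
  let R : Setoid V :=
    { r := fun x y => x = y ∨ x ∈ comp G ω v ∧ y ∈ comp G ω v
      iseqv := ⟨fun x => Or.inl rfl, by rintro x y (rfl | h); exacts [Or.inl rfl, Or.inr h.symm], by
        rintro x y z (rfl | h) (rfl | h')
        exacts [Or.inl rfl, Or.inr h', Or.inr h, Or.inr ⟨h.1, h'.2⟩]⟩ }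
  obtain ⟨q, hq, hD⟩ := h.coarsen R (by
    rintro x y (rfl | h)
    · rfl
    · rw [play_of_mem h.1, play_of_mem h.2]) (fun x y hxy => Or.inl hxy)
  have hq : ∀ x y, q x = q y ↔ (x = y ∨ x ∈ comp G ω v ∧ y ∈ comp G ω v) := hq
  have hvv : v ∈ comp G ω v := SimpleGraph.Reachable.refl v
  suffices H : ∀ {A : Set V} {d : C} {k : ℕ}, Der G q (play G ω (v, e)) A d k →
      (v ∉ A → Der G id ω A d k) ∧ (v ∈ A → Der G id ω A d (k + 1)) from (H hD).2 trivial
  clear hD h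
  intro A d k hD
  induction hD with
  | leaf w =>
    by_cases hw : w ∈ comp G ω v
    · have hA : {x | q x = q w} = comp G ω v := by
        ext x
        simp only [Set.mem_ofPred_eq, hq]
        constructor
        · rintro (rfl | h)
          exacts [hw, h.1]
        · intro h; exact Or.inr ⟨h, hw⟩
      rw [hA, play_of_mem hw]
      refine ⟨fun h => absurd hvv h, fun _ => ?_⟩
      exact (Der.of_mono (connected_comp v) fun x hx => (eq_of_mem_comp hx).symm).recol e
    · have hA : {x | q x = q w} = {w} := by
        ext x
        simp [hq, hw]
      rw [hA, play_of_notMem hw]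
      refine ⟨fun _ => leaf_id ω w, ?_⟩
      rintro rfl
      exact absurd hvv hw
  | recol d' _ ih => exact ⟨fun h => (ih.1 h).recol d', fun h => (ih.2 h).recol d'⟩
  | merge _ _ hd he ih₁ ih₂ =>
    refine ⟨fun h => (ih₁.1 fun h' => h (Or.inl h')).merge (ih₂.1 fun h' => h (Or.inr h')) hd he, ?_⟩
    rintro (h | h)
    · rw [add_right_comm]
      exact (ih₁.2 h).merge (ih₂.1 (Set.disjoint_left.1 hd h)) hd he
    · rw [add_assoc]
      exact (ih₁.1 (Set.disjoint_right.1 hd h)).merge (ih₂.2 h) hd he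

/-- Once the leaves are the monochromatic components, a recolouring applied directly to a leaf is a
move. Playing it makes that recolouring unnecessary and leaves the rest of the derivation intact. -/
theorem Der.exists_move [Fintype V] {d : C} {k : ℕ} (h : Der G id ω Set.univ d k) :
    k = 0 ∧ (∀ x, ω x = d) ∨ ∃ m l, k = l + 1 ∧ Der G id (play G ω m) Set.univ d l := by
  obtain ⟨q, hq, hD⟩ := h.coarsen (monoGraph G ω).reachableSetoid
    (fun x y hxy => eq_of_mem_comp hxy) (fun x y hxy => by cases hxy; exact SimpleGraph.Reachable.refl _)
  have hq : ∀ x y, q x = q y ↔ y ∈ comp G ω x := hq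
  have hqω : ∀ x y, q x = q y → ω x = ω y := fun x y hxy => eq_of_mem_comp ((hq x y).1 hxy)
  have hfib : ∀ v, {x | q x = q v} = comp G ω v := by
    intro v; ext x; rw [← hq]; exact eq_comm
  have hqc : ∀ v, (G.induce {x | q x = q v}).Connected := fun v => hfib v ▸ connected_comp v
  suffices H : ∀ {A : Set V} {d : C} {k : ℕ}, Der G q ω A d k →
      (k = 0 ∧ ∃ v, A = comp G ω v ∧ ω v = d) ∨
      ∃ v e l, v ∈ A ∧ k = l + 1 ∧ Der G id (play G ω (v, e)) A d l by
    rcases H hD with ⟨h0, v, hv, hd⟩ | ⟨v, e, l, -, hl, hD⟩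
    · exact Or.inl ⟨h0, fun x => (eq_of_mem_comp (hv ▸ trivial : x ∈ comp G ω v)).symm.trans hd⟩
    · exact Or.inr ⟨_, l, hl, hD⟩
  clear hD h
  intro A d k hD
  induction hD with
  | leaf v => exact Or.inl ⟨rfl, v, hfib v, rfl⟩
  | @recol A d k d' hA ih =>
    right
    rcases ih with ⟨rfl, v, rfl, -⟩ | ⟨v, e, l, hv, rfl, hD⟩
    · exact ⟨v, d', 0, SimpleGraph.Reachable.refl v, rfl,
        .of_mono (connected_comp v) fun x hx => play_of_mem hx⟩
    · exact ⟨v, e, l + 1, hv, rfl, hD.recol d'⟩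
  | @merge A B d k l hA hB hd he ihA ihB =>
    -- Derived sets are unions of monochromatic components, so a move inside `Q` changes no colour
    -- in a disjoint `P`.
    have hoff : ∀ {P Q : Set V} {j : ℕ} {v : V} {e : C}, Der G q ω P d j → v ∈ Q → Disjoint P Q →
        Der G id (play G ω (v, e)) P d j := by
      intro P Q j v e hP hv hPQ
      refine hP.refine hqω hqc fun x hx => play_of_notMem fun hxv => ?_
      exact Set.disjoint_left.1 hPQ (hP.saturated hx ((hq _ _).2 hxv)) hv
    rcases ihA with ⟨rfl, v, rfl, hv⟩ | ⟨v, e, k', hv, rfl, hD⟩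
    · rcases ihB with ⟨rfl, w, rfl, hw⟩ | ⟨w, e, l', hw, rfl, hD⟩
      -- Two components of the same colour joined by an edge would be one component, hence not
      -- disjoint.
      · exfalso
        obtain ⟨a, ha, b, hb, hab⟩ := he
        have hab' : (monoGraph G ω).Adj a b :=
          ⟨hab, by rw [← eq_of_mem_comp ha, ← eq_of_mem_comp hb, hv, hw]⟩
        have hb' : b ∈ comp G ω v := SimpleGraph.Reachable.trans ha hab'.reachable
        exact Set.disjoint_left.1 hd hb' hb
      · exact Or.inr ⟨w, e, 0 + l', Or.inr hw, by omega, (hoff hA hw hd).merge hD hd he⟩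
    · exact Or.inr ⟨v, e, k' + l, Or.inl hv, by omega, hD.merge (hoff hB hv hd.symm) hd he⟩

theorem exists_playSeq_iff [Fintype V] (hG : G.Connected) (d : C) (k : ℕ) :
    (∃ S : List (V × C), S.length = k ∧ ∀ v, playSeq G ω S v = d) ↔ Der G id ω Set.univ d k := by
  constructor
  · rintro ⟨S, rfl, hS⟩
    induction S generalizing ω with
    | nil => exact .of_mono ((SimpleGraph.induceUnivIso G).connected_iff.2 hG) fun x _ => hS x
    | cons m S ih => exact (ih hS).of_play
  · intro h
    induction k generalizing ω with
    | zero =>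
      rcases h.exists_move with ⟨-, h⟩ | ⟨_, _, h, _⟩
      · exact ⟨[], rfl, h⟩
      · omega
    | succ k ih =>
      rcases h.exists_move with ⟨h, -⟩ | ⟨m, l, hl, h⟩
      · omega
      · obtain rfl : k = l := by omega
        obtain ⟨S, hS, hS'⟩ := ih h
        exact ⟨m :: S, by simp [hS], hS'⟩

theorem minMovesTo_eq [Fintype V] (hG : G.Connected) {d : C} {k : ℕ}
    (h : Der G id ω Set.univ d k) (hmin : ∀ l, Der G id ω Set.univ d l → k ≤ l) :
    minMovesTo G ω d = k := by
  apply le_antisymm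
  · obtain ⟨S, rfl, hS⟩ := (exists_playSeq_iff hG d k).2 h
    exact iInf₂_le S hS
  · refine le_iInf₂ fun S hS => ?_
    exact_mod_cast hmin _ ((exists_playSeq_iff hG d _).1 ⟨S, rfl, hS⟩)

end Moves

end FloodIt

namespace FloodIt

/-! ### A small language of expressions and statements, compiled to the word RAM

Registers below `10` are variables; the compiled code uses registers from `10` on for intermediate
results. Loops restore their loop variable. -/

section Language

/-- Running sum (`m = false`) or running minimum (`m = true`) of `a` and `f 0, …, f (n - 1)`. -/
def foldUpTo (m : Bool) (a : ℕ) (f : ℕ → ℕ) : ℕ → ℕ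
  | 0 => a
  -- With truncated subtraction, `a - (a - b)` is `min a b`; the minimum thus needs no branching.
  | n + 1 => bif m then foldUpTo m a f n - (foldUpTo m a f n - f n) else foldUpTo m a f n + f n

theorem foldUpTo_false (a : ℕ) (f : ℕ → ℕ) (n : ℕ) :
    foldUpTo false a f n = a + ∑ k ∈ Finset.range n, f k := by
  induction n with
  | zero => rfl
  | succ n ih => rw [Finset.sum_range_succ, foldUpTo, ih]; simp [add_assoc]

theorem foldUpTo_true_succ (a : ℕ) (f : ℕ → ℕ) (n : ℕ) :
    foldUpTo true a f (n + 1) = min (foldUpTo true a f n) (f n) := by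
  simp only [foldUpTo, cond_true]; omega

theorem foldUpTo_true_le (a : ℕ) (f : ℕ → ℕ) (n z : ℕ) :
    foldUpTo true a f n ≤ z ↔ a ≤ z ∨ ∃ k < n, f k ≤ z := by
  induction n with
  | zero => simp [foldUpTo]
  | succ n ih =>
    rw [foldUpTo_true_succ, min_le_iff, ih, or_assoc]
    refine or_congr_right ⟨?_, ?_⟩
    · rintro (⟨k, hk, h⟩ | h)
      exacts [⟨k, by omega, h⟩, ⟨n, by omega, h⟩]
    · rintro ⟨k, hk, h⟩
      rcases Nat.lt_succ_iff_lt_or_eq.1 hk with hk | rfl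
      exacts [Or.inl ⟨k, hk, h⟩, Or.inr h]

theorem foldUpTo_le (m : Bool) {a b B : ℕ} {f : ℕ → ℕ} (ha : a ≤ b) {n : ℕ} (hf : ∀ k < n, f k ≤ B) :
    foldUpTo m a f n ≤ b + n * B := by
  induction n with
  | zero => simpa [foldUpTo]
  | succ n ih =>
    have h1 := ih fun k hk => hf k (by omega)
    have h2 := hf n (by omega)
    cases m <;> simp only [foldUpTo, cond_true, cond_false] <;> rw [Nat.succ_mul] <;> omega

theorem foldUpTo_congr (m : Bool) {a b : ℕ} {f g : ℕ → ℕ} (ha : a = b) {n : ℕ}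
    (hf : ∀ k < n, f k = g k) : foldUpTo m a f n = foldUpTo m b g n := by
  induction n with
  | zero => simpa [foldUpTo]
  | succ n ih => simp only [foldUpTo, ih fun k hk => hf k (by omega), hf n (by omega)]

/-- Expressions; `fold m x y a e` is the sum or minimum of `a` and the values of `e` for all values of
the variable `x` below that of `y`. -/
inductive Ex where
  | var (r : ℕ)
  | const (k : ℕ)
  | add (a b : Ex)
  | sub (a b : Ex)
  | mul (a b : Ex)
  | load (a : Ex)
  | fold (m : Bool) (x y : ℕ) (a e : Ex)

namespace Ex

def eval : Ex → (ℕ → ℕ) → (ℕ → ℕ) → ℕ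
  | var r, env, _ => env r
  | const k, _, _ => k
  | add a b, env, mem => a.eval env mem + b.eval env mem
  | sub a b, env, mem => a.eval env mem - b.eval env mem
  | mul a b, env, mem => a.eval env mem * b.eval env mem
  | load a, env, mem => mem (a.eval env mem)
  | fold m x y a e, env, mem =>
    foldUpTo m (a.eval env mem) (fun k => e.eval (Function.update env x k) mem) (env y)

/-- Variables are below `10`; only the variables `0`, `1`, `2` bound loops, and they are not used as
loop variables. -/
def Wf : Ex → Prop
  | var r => r < 10
  | const _ => True
  | add a b | sub a b | mul a b => a.Wf ∧ b.Wf
  | load a => a.Wf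
  | fold _ x y a e => (3 ≤ x ∧ x < 10 ∧ y < 3) ∧ a.Wf ∧ e.Wf

/-- A bound for all numbers occurring in the evaluation when all variables and memory cells are
at most `X`. -/
def bd : Ex → ℕ → ℕ
  | var _, X => X
  | const k, _ => k
  | add a b, X | sub a b, X => a.bd X + b.bd X
  | mul a b, X => a.bd X * b.bd X + (a.bd X + b.bd X)
  | load a, X => a.bd X + X
  | fold _ _ _ a e, X => (a.bd X + X * e.bd X) + (e.bd X + (X + 1))

/-- The shape follows `bd` term by term, so that `polyBound_add` and `polyBound_mul` apply directly.
Degrees are added even for sums, which is crude but sufficient. -/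
def deg : Ex → ℕ
  | var _ => 1
  | const _ => 0
  | add a b | sub a b => a.deg + b.deg
  | mul a b => (a.deg + b.deg) + (a.deg + b.deg)
  | load a => a.deg + 1
  | fold _ _ _ a e => (a.deg + (1 + e.deg)) + (e.deg + (1 + 0))

/-- A bound for the running time when the variables `0`, `1`, `2` are bounded by `l`. -/
def time : Ex → (ℕ → ℕ) → ℕ
  | var _, _ => 2
  | const _, _ => 1
  | add a b, l | sub a b, l | mul a b, l => a.time l + b.time l + 1
  | load a, l => a.time l + 1
  | fold _ _ y a e, l => a.time l + l y * (e.time l + 5) + 6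

/-- The result goes to register `t`, and registers from `t` on are scratch. There is no copy
instruction, so copying is done by adding to zero. In a fold, `t` accumulates, `t + 1` keeps the old
value of `x`, and the body works from `t + 2` on. -/
def compile : Ex → ℕ → Prog
  | var r, t => .seq (.instr (.const t 0)) (.instr (.add t t r))
  | const k, t => .instr (.const t k)
  | add a b, t => .seq (a.compile t) (.seq (b.compile (t + 1)) (.instr (.add t t (t + 1))))
  | sub a b, t => .seq (a.compile t) (.seq (b.compile (t + 1)) (.instr (.sub t t (t + 1))))
  | mul a b, t => .seq (a.compile t) (.seq (b.compile (t + 1)) (.instr (.mul t t (t + 1))))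
  | load a, t => .seq (a.compile t) (.instr (.load t t))
  | fold m x y a e, t =>
    .seq (a.compile t) <| .seq (.instr (.const (t + 1) 0)) <| .seq (.instr (.add (t + 1) (t + 1) x)) <|
    .seq (.instr (.const x 0)) <|
    .seq (.loop (.lt x y) <| .seq (e.compile (t + 2)) <|
      .seq (bif m then .seq (.instr (.sub (t + 2) t (t + 2))) (.instr (.sub t t (t + 2)))
        else .instr (.add t t (t + 2))) <|
      .seq (.instr (.const (t + 2) 1)) (.instr (.add x x (t + 2)))) <|
    .seq (.instr (.const x 0)) (.instr (.add x x (t + 1)))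

end Ex

/-- Statements; `forTo x y p` repeats `p` for `x = 0, 1, …` as long as `x` is below `y`. -/
inductive Stmt where
  | set (x : ℕ) (e : Ex)
  | put (a b : Ex)
  | seq (p q : Stmt)
  | forTo (x y : ℕ) (p : Stmt)

namespace Stmt

def Wf : Stmt → Prop
  | set x e => x < 10 ∧ e.Wf
  | put a b => a.Wf ∧ b.Wf
  | seq p q => p.Wf ∧ q.Wf
  | forTo x y p => (3 ≤ x ∧ x < 10 ∧ y < 3) ∧ p.Wf

def bd : Stmt → ℕ → ℕ
  | set _ e, X => e.bd X
  | put a b, X => a.bd X + b.bd X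
  | seq p q, X => p.bd X + q.bd X
  | forTo _ _ p, X => p.bd X + (X + 1)

def deg : Stmt → ℕ
  | set _ e => e.deg
  | put a b => a.deg + b.deg
  | seq p q => p.deg + q.deg
  | forTo _ _ p => p.deg + (1 + 0)

def time : Stmt → (ℕ → ℕ) → ℕ
  | set _ e, l => e.time l + 2
  | put a b, l => a.time l + b.time l + 1
  | seq p q, l => p.time l + q.time l
  | forTo _ y p, l => l y * (p.time l + 3) + 6

def compile : Stmt → ℕ → Prog
  | set x e, t => .seq (e.compile t) <| .seq (.instr (.const x 0)) (.instr (.add x x t))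
  | put a b, t => .seq (a.compile t) <| .seq (b.compile (t + 1)) (.instr (.store t (t + 1)))
  | seq p q, t => .seq (p.compile t) (q.compile t)
  | forTo x y p, t =>
    .seq (.instr (.const t 0)) <| .seq (.instr (.add t t x)) <| .seq (.instr (.const x 0)) <|
    .seq (.loop (.lt x y) <| .seq (p.compile (t + 1)) <|
      .seq (.instr (.const (t + 1) 1)) (.instr (.add x x (t + 1)))) <|
    .seq (.instr (.const x 0)) (.instr (.add x x t))

end Stmt

/-! ### Polynomial bounds -/

/-- Bounds are kept in the form `f 1 * X ^ p`: for a polynomial with nonnegative coefficients the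
value at `1` is the sum of the coefficients. This yields an explicit constant without computing it.
-/
theorem polyBound_add {f g : ℕ → ℕ} {p q X : ℕ} (hX : 1 ≤ X) (hf : f X ≤ f 1 * X ^ p)
    (hg : g X ≤ g 1 * X ^ q) : f X + g X ≤ (f 1 + g 1) * X ^ (p + q) := by
  rw [add_mul]
  refine add_le_add (hf.trans ?_) (hg.trans ?_) <;>
    exact Nat.mul_le_mul_left _ (Nat.pow_le_pow_right hX (by omega))

theorem polyBound_mul {f g : ℕ → ℕ} {p q X : ℕ} (hf : f X ≤ f 1 * X ^ p)
    (hg : g X ≤ g 1 * X ^ q) : f X * g X ≤ (f 1 * g 1) * X ^ (p + q) := by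
  refine (Nat.mul_le_mul hf hg).trans (le_of_eq ?_)
  ring

theorem Ex.bd_le (e : Ex) {X : ℕ} (hX : 1 ≤ X) : e.bd X ≤ e.bd 1 * X ^ e.deg := by
  have hid : (fun X => X) X ≤ (fun X => X) 1 * X ^ 1 := by simp
  have hone : (fun _ => 1) X ≤ (fun _ : ℕ => 1) 1 * X ^ 0 := by simp
  induction e with
  | var r => exact hid
  | const k => simp [bd, deg]
  | add a b iha ihb => exact polyBound_add hX iha ihb
  | sub a b iha ihb => exact polyBound_add hX iha ihb
  | mul a b iha ihb =>
    exact polyBound_add (f := fun X => a.bd X * b.bd X) (g := fun X => a.bd X + b.bd X) hX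
      (polyBound_mul iha ihb) (polyBound_add hX iha ihb)
  | load a ih => exact polyBound_add (g := fun X => X) hX ih hid
  | fold m x y a e iha ihe =>
    exact polyBound_add (f := fun X => a.bd X + X * e.bd X) (g := fun X => e.bd X + (X + 1)) hX
      (polyBound_add (g := fun X => X * e.bd X) hX iha (polyBound_mul (f := fun X => X) hid ihe))
      (polyBound_add (g := fun X => X + 1) hX ihe
        (polyBound_add (f := fun X => X) (g := fun _ => 1) hX hid hone))

theorem Stmt.bd_le (p : Stmt) {X : ℕ} (hX : 1 ≤ X) : p.bd X ≤ p.bd 1 * X ^ p.deg := by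
  have hid : (fun X => X) X ≤ (fun X => X) 1 * X ^ 1 := by simp
  have hone : (fun _ => 1) X ≤ (fun _ : ℕ => 1) 1 * X ^ 0 := by simp
  induction p with
  | set x e => exact e.bd_le hX
  | put a b => exact polyBound_add hX (a.bd_le hX) (b.bd_le hX)
  | seq p q ihp ihq => exact polyBound_add hX ihp ihq
  | forTo x y p ih =>
    exact polyBound_add (g := fun X => X + 1) hX ih
        (polyBound_add (f := fun X => X) (g := fun _ => 1) hX hid hone)

/-! ### Correctness of the compilation -/

/-- `N` only bounds the number of rounds, through `k < N` whenever the test holds; the exact number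
may depend on the run. The induction is on the rounds still possible. -/
theorem Exec.loop_rule {W : ℕ} {b : Test} {p : Prog} {T N : ℕ} (I : ℕ → State → Prop)
    (hstep : ∀ k s, I k s → b.Holds s → k < N ∧ ∃ s' τ, Exec W p s s' τ ∧ τ ≤ T ∧ I (k + 1) s')
    {s : State} (h0 : I 0 s) :
    ∃ k s' τ, Exec W (.loop b p) s s' τ ∧ τ ≤ N * (T + 1) + 1 ∧ I k s' ∧ ¬ b.Holds s' := by
  suffices H : ∀ j k s, N - k ≤ j → I k s →
      ∃ k s' τ, Exec W (.loop b p) s s' τ ∧ τ ≤ j * (T + 1) + 1 ∧ I k s' ∧ ¬ b.Holds s' from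
    H N 0 s (by omega) h0
  intro j
  induction j with
  | zero =>
    intro k s hk hI
    by_cases hb : b.Holds s
    · have := (hstep k s hI hb).1
      omega
    · exact ⟨k, s, 1, .loop_false hb, by omega, hI, hb⟩
  | succ j ih =>
    intro k s hk hI
    by_cases hb : b.Holds s
    · obtain ⟨hkN, s₁, τ₁, h₁, hτ₁, hI₁⟩ := hstep k s hI hb
      obtain ⟨k', s₂, τ₂, h₂, hτ₂, hI₂, hb₂⟩ := ih (k + 1) s₁ (by omega) hI₁
      exact ⟨k', s₂, _, .loop_true hb h₁ h₂, by rw [Nat.succ_mul]; omega, hI₂, hb₂⟩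
    · exact ⟨k, s, 1, .loop_false hb, by omega, hI, hb⟩

theorem Ex.eval_le {e : Ex} (hwf : e.Wf) {env mem : ℕ → ℕ} {X : ℕ} (henv : ∀ r, env r ≤ X)
    (hmem : ∀ a, mem a ≤ X) : e.eval env mem ≤ e.bd X := by
  induction e generalizing env with
  | var r => exact henv r
  | const k => exact le_rfl
  | add a b iha ihb => exact add_le_add (iha hwf.1 henv) (ihb hwf.2 henv)
  | sub a b iha ihb =>
    have := iha hwf.1 henv
    simp only [eval, bd]; omega
  | mul a b iha ihb =>
    have := Nat.mul_le_mul (iha hwf.1 henv) (ihb hwf.2 henv)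
    simp only [eval, bd]; omega
  | load a ih =>
    have := hmem (a.eval env mem)
    simp only [eval, bd]; omega
  | fold m x y a e iha ihe =>
    have h1 := iha hwf.2.1 henv
    have h2 : ∀ k < env y, e.eval (Function.update env x k) mem ≤ e.bd X := by
      intro k hk
      refine ihe hwf.2.2 fun r => ?_
      by_cases hr : r = x
      · subst hr; simpa using hk.le.trans (henv y)
      · simpa [hr] using henv r
    have h3 := foldUpTo_le m h1 h2
    have h4 := Nat.mul_le_mul_right (e.bd X) (henv y)
    simp only [eval, bd]; omega

variable {W X : ℕ} {l : ℕ → ℕ}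

/-- The values of variables and memory are within the bounds. -/
structure Ok (X : ℕ) (l : ℕ → ℕ) (env mem : ℕ → ℕ) : Prop where
  env_le : ∀ r, env r ≤ X
  mem_le : ∀ a, mem a ≤ X
  lim_le : ∀ y < 3, env y ≤ l y

theorem Ok.update {env mem : ℕ → ℕ} (h : Ok X l env mem) {x k : ℕ} (hx : 3 ≤ x) (hk : k ≤ X) :
    Ok X l (Function.update env x k) mem where
  env_le r := by
    by_cases hr : r = x
    · subst hr; simpa using hk
    · simpa [hr] using h.env_le r
  mem_le := h.mem_le
  lim_le y hy := by
    rw [Function.update_of_ne (by omega)]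
    exact h.lim_le y hy

theorem Ex.exec {e : Ex} (hwf : e.Wf) (hW : e.bd X ≤ W) {env mem : ℕ → ℕ} (hok : Ok X l env mem)
    {t : ℕ} (ht : 10 ≤ t) {s : State} (hs : ∀ r < 10, s.reg r = env r) (hm : s.mem = mem) :
    ∃ s' τ, Exec W (e.compile t) s s' τ ∧ τ ≤ e.time l ∧ s'.mem = mem ∧
      s'.reg t = e.eval env mem ∧ ∀ r < t, s'.reg r = s.reg r := by
  induction e generalizing env t s with
  | var r =>
    have hr : r < 10 := hwf
    refine ⟨_, _, .seq (.instr _ _ (Nat.zero_le _)) (.instr _ _ ?_), le_rfl, hm, ?_, ?_⟩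
    · have := hok.env_le r
      simp only [bd] at hW
      simp [Instr.value, Instr.exec, Function.update_of_ne (show r ≠ t by omega), hs r hr]
      omega
    · simp [Instr.value, Instr.exec, Function.update_of_ne (show r ≠ t by omega), hs r hr, eval]
    · intro r' hr'
      simp [Instr.exec, Function.update_of_ne (show r' ≠ t by omega)]
  | const k =>
    refine ⟨_, _, .instr _ _ hW, le_rfl, hm, ?_, ?_⟩
    · simp [Instr.value, Instr.exec, eval]
    · intro r' hr'
      simp [Instr.exec, Function.update_of_ne (show r' ≠ t by omega)]
  | add a b iha ihb =>
    have hv := Ex.eval_le (e := .add a b) hwf hok.env_le hok.mem_le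
    have hW' : a.bd X + b.bd X ≤ W := hW
    obtain ⟨s₁, τ₁, h₁, hτ₁, hm₁, hr₁, hf₁⟩ := iha hwf.1 (by omega) hok ht hs hm
    obtain ⟨s₂, τ₂, h₂, hτ₂, hm₂, hr₂, hf₂⟩ := ihb hwf.2 (by omega) hok (t := t + 1) (by omega)
      (fun r hr => (hf₁ r (by omega)).trans (hs r hr)) hm₁
    have hrt := (hf₂ t (by omega)).trans hr₁
    refine ⟨_, _, .seq h₁ (.seq h₂ (.instr _ _ ?_)), ?_, hm₂, ?_, ?_⟩
    · simp only [Instr.value, hr₂, hrt]; exact hv.trans hW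
    · simp only [time]; omega
    · simp [Instr.value, Instr.exec, hr₂, hrt, eval]
    · intro r hr
      simp only [Instr.exec, Function.update_of_ne (show r ≠ t by omega)]
      rw [hf₂ r (by omega), hf₁ r hr]
  | sub a b iha ihb =>
    have hv := Ex.eval_le (e := .sub a b) hwf hok.env_le hok.mem_le
    have hW' : a.bd X + b.bd X ≤ W := hW
    obtain ⟨s₁, τ₁, h₁, hτ₁, hm₁, hr₁, hf₁⟩ := iha hwf.1 (by omega) hok ht hs hm
    obtain ⟨s₂, τ₂, h₂, hτ₂, hm₂, hr₂, hf₂⟩ := ihb hwf.2 (by omega) hok (t := t + 1) (by omega)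
      (fun r hr => (hf₁ r (by omega)).trans (hs r hr)) hm₁
    have hrt := (hf₂ t (by omega)).trans hr₁
    refine ⟨_, _, .seq h₁ (.seq h₂ (.instr _ _ ?_)), ?_, hm₂, ?_, ?_⟩
    · simp only [Instr.value, hr₂, hrt]; exact hv.trans hW
    · simp only [time]; omega
    · simp [Instr.value, Instr.exec, hr₂, hrt, eval]
    · intro r hr
      simp only [Instr.exec, Function.update_of_ne (show r ≠ t by omega)]
      rw [hf₂ r (by omega), hf₁ r hr]
  | mul a b iha ihb =>
    have hv := Ex.eval_le (e := .mul a b) hwf hok.env_le hok.mem_le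
    have hW' : a.bd X * b.bd X + (a.bd X + b.bd X) ≤ W := hW
    obtain ⟨s₁, τ₁, h₁, hτ₁, hm₁, hr₁, hf₁⟩ := iha hwf.1 (by omega) hok ht hs hm
    obtain ⟨s₂, τ₂, h₂, hτ₂, hm₂, hr₂, hf₂⟩ := ihb hwf.2 (by omega) hok (t := t + 1) (by omega)
      (fun r hr => (hf₁ r (by omega)).trans (hs r hr)) hm₁
    have hrt := (hf₂ t (by omega)).trans hr₁
    refine ⟨_, _, .seq h₁ (.seq h₂ (.instr _ _ ?_)), ?_, hm₂, ?_, ?_⟩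
    · simp only [Instr.value, hr₂, hrt]; exact hv.trans hW
    · simp only [time]; omega
    · simp [Instr.value, Instr.exec, hr₂, hrt, eval]
    · intro r hr
      simp only [Instr.exec, Function.update_of_ne (show r ≠ t by omega)]
      rw [hf₂ r (by omega), hf₁ r hr]
  | load a ih =>
    have hW' : a.bd X + X ≤ W := hW
    obtain ⟨s₁, τ₁, h₁, hτ₁, hm₁, hr₁, hf₁⟩ := ih hwf (by omega) hok ht hs hm
    refine ⟨_, _, .seq h₁ (.instr _ _ ?_), ?_, hm₁, ?_, ?_⟩
    · simp only [Instr.value, hm₁]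
      have := hok.mem_le (s₁.reg t)
      omega
    · simp only [time]; omega
    · simp [Instr.value, Instr.exec, hr₁, hm₁, eval]
    · intro r hr
      simp only [Instr.exec, Function.update_of_ne (show r ≠ t by omega)]
      rw [hf₁ r hr]
  | fold m x y a e iha ihe =>
    obtain ⟨⟨hx3, hx, hy⟩, hwa, hwe⟩ := hwf
    have hW' : (a.bd X + X * e.bd X) + (e.bd X + (X + 1)) ≤ W := hW
    obtain ⟨s₁, τ₁, h₁, hτ₁, hm₁, hr₁, hf₁⟩ := iha hwa (by omega) hok ht hs hm
    set s₂ : State := ⟨Function.update (Function.update s₁.reg (t + 1) (env x)) x 0, mem⟩ with hs₂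
    set F := foldUpTo m (a.eval env mem) (fun k => e.eval (Function.update env x k) mem) with hF
    have hFle : ∀ k ≤ env y, F k ≤ W := by
      intro k hk
      have h1 := Ex.eval_le hwa hok.env_le hok.mem_le
      have h2 : ∀ j < k, e.eval (Function.update env x j) mem ≤ e.bd X := fun j hj =>
        Ex.eval_le hwe (hok.update hx3 (by have := hok.env_le y; omega)).env_le hok.mem_le
      have h3 := foldUpTo_le m h1 h2
      have h4 := Nat.mul_le_mul_right (e.bd X) (hk.trans (hok.env_le y))
      change foldUpTo m _ _ _ ≤ W
      omega
    -- Invariant: `t` holds the partial fold `F k`, `t + 1` the saved value of `x`, and everything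
    -- else below `t` is untouched.
    have hloop := Exec.loop_rule (W := W) (b := .lt x y) (T := e.time l + 4) (N := env y)
      (p := .seq (e.compile (t + 2)) <|
        .seq (bif m then .seq (.instr (.sub (t + 2) t (t + 2))) (.instr (.sub t t (t + 2)))
          else .instr (.add t t (t + 2))) <|
        .seq (.instr (.const (t + 2) 1)) (.instr (.add x x (t + 2))))
      (fun k s' => k ≤ env y ∧ s'.reg x = k ∧ s'.reg t = F k ∧ s'.reg (t + 1) = env x ∧
        s'.mem = mem ∧ ∀ r < t, r ≠ x → s'.reg r = s.reg r) ?_ (s := s₂) ?_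
    · obtain ⟨k, s₃, τ₃, h₃, hτ₃, ⟨hk, hxk, hrt, hrt1, hm₃, hf₃⟩, hb⟩ := hloop
      have hky : k = env y := by
        simp only [Test.Holds, hxk, hf₃ y (by omega) (by omega), hs y (by omega)] at hb
        omega
      refine ⟨⟨Function.update s₃.reg x (env x), mem⟩, _, .seq h₁ <| .seq (.instr _ _ (Nat.zero_le _)) <|
        .seq (.instr _ _ ?_) <| .seq (.instr _ _ (Nat.zero_le _)) <| .seq (s₁ := s₃) (t₁ := τ₃) ?_ <|
        .seq (t₂ := 1) (.instr _ _ (Nat.zero_le _)) ?_, ?_, rfl, ?_, ?_⟩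
      · have := hok.env_le x
        simp [Instr.value, Instr.exec, Function.update_of_ne (show x ≠ t + 1 by omega),
          hf₁ x (by omega), hs x hx]
        omega
      · convert h₃ using 1
        simp [hs₂, Instr.exec, Instr.value, hm₁, Function.update_of_ne (show x ≠ t + 1 by omega),
          hf₁ x (by omega), hs x hx]
      · have hi := Exec.instr (W := W) (.add x x (t + 1)) (Instr.exec (.const x 0) s₃) (by
          have := hok.env_le x
          simp [Instr.value, Instr.exec, Function.update_of_ne (show t + 1 ≠ x by omega), hrt1]
          omega)
        convert hi using 1
        simp [Instr.exec, Instr.value, hm₃, Function.update_of_ne (show t + 1 ≠ x by omega), hrt1]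
      · simp only [time]
        have := Nat.mul_le_mul_right (e.time l + 5) (hok.lim_le y hy)
        have h5 : e.time l + 4 + 1 = e.time l + 5 := by omega
        rw [h5] at hτ₃
        omega
      · simp only [Function.update_of_ne (show t ≠ x by omega), hrt, eval, hky, hF]
      · intro r hr
        by_cases hrx : r = x
        · subst hrx; simp [hs r hx]
        · simp only [Function.update_of_ne hrx, hf₃ r hr hrx]
    · rintro k s' ⟨hk, hxk, hrt, hrt1, hm', hf'⟩ hb
      have hky : k < env y := by
        simpa only [Test.Holds, hxk, hf' y (by omega) (by omega), hs y (by omega)] using hb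
      refine ⟨hky, ?_⟩
      have hkX := hok.env_le y
      obtain ⟨s₄, τ₄, h₄, hτ₄, hm₄, hr₄, hf₄⟩ := ihe (env := Function.update env x k) hwe (by omega)
        (hok.update hx3 (by omega)) (t := t + 2) (by omega) (s := s') (by
          intro r hr
          by_cases hrx : r = x
          · subst hrx; simp [hxk]
          · rw [Function.update_of_ne hrx, hf' r (by omega) hrx, hs r hr]) hm'
      have hmid : ∃ s₅ τ₅, Exec W (bif m then .seq (.instr (.sub (t + 2) t (t + 2)))
          (.instr (.sub t t (t + 2))) else .instr (.add t t (t + 2))) s₄ s₅ τ₅ ∧ τ₅ ≤ 2 ∧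
          s₅.mem = mem ∧ s₅.reg t = F (k + 1) ∧ ∀ r < t + 2, r ≠ t → s₅.reg r = s₄.reg r := by
        have h4t : s₄.reg t = F k := (hf₄ t (by omega)).trans hrt
        have hFk := hFle k hk
        have hFk1 := hFle (k + 1) hky
        cases m
        · refine ⟨_, _, .instr _ _ ?_, by omega, hm₄, ?_, ?_⟩
          · simp only [Instr.value, h4t, hr₄]
            exact hFk1
          · simp only [Instr.exec, Instr.value, Function.update_self, h4t, hr₄]
            rfl
          · intro r hr hrt'
            simp [Instr.exec, hrt']
        · refine ⟨_, _, .seq (.instr _ _ ?_) (.instr _ _ ?_), le_rfl, hm₄, ?_, ?_⟩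
          · simp only [Instr.value, h4t]
            omega
          · simp only [Instr.value, Instr.exec, Function.update_of_ne (show t ≠ t + 2 by omega), h4t]
            omega
          · simp only [Instr.value, Instr.exec, Function.update_of_ne (show t ≠ t + 2 by omega),
              Function.update_self, h4t, hr₄]
            rfl
          · intro r hr hrt'
            simp [Instr.exec, hrt', Function.update_of_ne (show r ≠ t + 2 by omega)]
      obtain ⟨s₅, τ₅, h₅, hτ₅, hm₅, hr₅, hf₅⟩ := hmid
      have hx5 : s₅.reg x = k := by rw [hf₅ x (by omega) (by omega), hf₄ x (by omega), hxk]
      refine ⟨_, _, .seq h₄ (.seq h₅ (.seq (.instr _ _ ?_) (.instr _ _ ?_))), by omega, hky, ?_, ?_, ?_,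
        hm₅, ?_⟩
      · simp only [Instr.value]; omega
      · simp only [Instr.value, Instr.exec, Function.update_self,
          Function.update_of_ne (show x ≠ t + 2 by omega), hx5]
        omega
      · simp only [Instr.value, Instr.exec, Function.update_self,
          Function.update_of_ne (show x ≠ t + 2 by omega), hx5]
      · simp only [Instr.exec, Function.update_of_ne (show t ≠ x by omega),
          Function.update_of_ne (show t ≠ t + 2 by omega), hr₅]
      · simp only [Instr.exec, Function.update_of_ne (show t + 1 ≠ x by omega),
          Function.update_of_ne (show t + 1 ≠ t + 2 by omega)]
        rw [hf₅ _ (by omega) (by omega), hf₄ _ (by omega), hrt1]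
      · intro r hr hrx
        simp only [Instr.exec, Function.update_of_ne hrx,
          Function.update_of_ne (show r ≠ t + 2 by omega)]
        rw [hf₅ _ (by omega) (by omega), hf₄ _ (by omega), hf' r hr hrx]
    · refine ⟨Nat.zero_le _, ?_, ?_, ?_, rfl, ?_⟩
      · simp [hs₂]
      · simp [hs₂, Function.update_of_ne (show t ≠ x by omega), hr₁, hF, foldUpTo]
      · simp [hs₂, Function.update_of_ne (show t + 1 ≠ x by omega)]
      · intro r hr hrx
        simp [hs₂, Function.update_of_ne hrx, Function.update_of_ne (show r ≠ t + 1 by omega), hf₁ r hr]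

/-- `Tri W X l p env mem Q`: started with variables `env` and memory `mem`, the compiled statement `p`
halts within its time bound, with variables and memory satisfying `Q`. -/
def Tri (W X : ℕ) (l : ℕ → ℕ) (p : Stmt) (env mem : ℕ → ℕ) (Q : (ℕ → ℕ) → (ℕ → ℕ) → Prop) : Prop :=
  p.Wf → p.bd X ≤ W → ∀ t, 10 ≤ t → ∀ s : State, (∀ r < 10, s.reg r = env r) → s.mem = mem →
    ∃ s' τ env', Exec W (p.compile t) s s' τ ∧ τ ≤ p.time l ∧ (∀ r < 10, s'.reg r = env' r) ∧
      (∀ r, 10 ≤ r → r < t → s'.reg r = s.reg r) ∧ Q env' s'.mem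

variable {env mem : ℕ → ℕ} {Q : (ℕ → ℕ) → (ℕ → ℕ) → Prop}

theorem Tri.set {x : ℕ} {e : Ex} (hok : Ok X l env mem)
    (hQ : Q (Function.update env x (e.eval env mem)) mem) : Tri W X l (.set x e) env mem Q := by
  rintro ⟨hx, hwf⟩ hW t ht s hs hm
  have hW' : e.bd X ≤ W := hW
  obtain ⟨s₁, τ₁, h₁, hτ₁, hm₁, hr₁, hf₁⟩ := Ex.exec hwf hW' hok ht hs hm
  have hv := (Ex.eval_le hwf hok.env_le hok.mem_le).trans hW'
  refine ⟨_, _, Function.update env x (e.eval env mem),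
    .seq h₁ (.seq (.instr _ _ (Nat.zero_le _)) (.instr _ _ ?_)), ?_, ?_, ?_, ?_⟩
  · simp [Instr.value, Instr.exec, Function.update_of_ne (show t ≠ x by omega), hr₁, hv]
  · simp only [Stmt.time]; omega
  · intro r hr
    by_cases hrx : r = x
    · subst hrx
      simp [Instr.value, Instr.exec, Function.update_of_ne (show t ≠ r by omega), hr₁]
    · simp [Instr.exec, hrx, hf₁ r (by omega), hs r hr]
  · intro r hr hrt
    simp [Instr.exec, Function.update_of_ne (show r ≠ x by omega), hf₁ r hrt]
  · simpa [Instr.exec, hm₁] using hQ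

theorem Tri.put {a b : Ex} (hok : Ok X l env mem)
    (hQ : Q env (Function.update mem (a.eval env mem) (b.eval env mem))) :
    Tri W X l (.put a b) env mem Q := by
  rintro ⟨hwa, hwb⟩ hW t ht s hs hm
  have hW' : a.bd X + b.bd X ≤ W := hW
  obtain ⟨s₁, τ₁, h₁, hτ₁, hm₁, hr₁, hf₁⟩ := Ex.exec (W := W) hwa (by omega) hok ht hs hm
  obtain ⟨s₂, τ₂, h₂, hτ₂, hm₂, hr₂, hf₂⟩ := Ex.exec (W := W) hwb (by omega) hok (t := t + 1) (by omega)
      (fun r hr => (hf₁ r (by omega)).trans (hs r hr)) hm₁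
  have hv := (Ex.eval_le hwb hok.env_le hok.mem_le)
  refine ⟨_, _, env, .seq h₁ (.seq h₂ (.instr _ _ ?_)), ?_, ?_, ?_, ?_⟩
  · simp only [Instr.value, hr₂]; omega
  · simp only [Stmt.time]; omega
  · intro r hr
    simp [Instr.exec, hf₂ r (by omega), hf₁ r (by omega), hs r hr]
  · intro r hr hrt
    simp [Instr.exec, hf₂ r (by omega), hf₁ r (by omega)]
  · simpa [Instr.exec, Instr.value, hm₂, hr₂, hf₂ t (by omega), hr₁] using hQ

theorem Tri.seq {p q : Stmt} (h : Tri W X l p env mem fun env' mem' => Tri W X l q env' mem' Q) :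
    Tri W X l (.seq p q) env mem Q := by
  rintro ⟨hwp, hwq⟩ hW t ht s hs hm
  have hW' : p.bd X + q.bd X ≤ W := hW
  obtain ⟨s₁, τ₁, env₁, h₁, hτ₁, hr₁, hf₁, hq⟩ := h hwp (by omega) t ht s hs hm
  obtain ⟨s₂, τ₂, env₂, h₂, hτ₂, hr₂, hf₂, hQ⟩ := hq hwq (by omega) t ht s₁ hr₁ rfl
  exact ⟨s₂, _, env₂, .seq h₁ h₂, by simp only [Stmt.time]; omega, hr₂,
    fun r hr hrt => (hf₂ r hr hrt).trans (hf₁ r hr hrt), hQ⟩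

theorem Tri.mono {p : Stmt} {Q' : (ℕ → ℕ) → (ℕ → ℕ) → Prop} (h : Tri W X l p env mem Q)
    (hQ : ∀ env' mem', Q env' mem' → Q' env' mem') : Tri W X l p env mem Q' := by
  intro hwf hW t ht s hs hm
  obtain ⟨s₁, τ₁, env₁, h₁, hτ₁, hr₁, hf₁, hq⟩ := h hwf hW t ht s hs hm
  exact ⟨s₁, τ₁, env₁, h₁, hτ₁, hr₁, hf₁, hQ _ _ hq⟩

/-- The body may change the limit `y`, as happens in the search, where the list grows while it is
scanned. Hence the number of rounds is bounded by `l y` instead of the initial value, and the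
invariant speaks of the variables with `x` restored. -/
theorem Tri.forTo {x y : ℕ} {p : Stmt} (I : ℕ → (ℕ → ℕ) → (ℕ → ℕ) → Prop) (hX : env x ≤ X)
    (h0 : I 0 env mem)
    (hstep : ∀ k env' mem', I k env' mem' → env' x = env x → k < env' y →
      (env' y ≤ l y ∧ env' y ≤ X) ∧ Tri W X l p (Function.update env' x k) mem' fun env'' mem'' =>
        env'' x = k ∧ I (k + 1) (Function.update env'' x (env x)) mem'')
    (hQ : ∀ k env' mem', I k env' mem' → env' y ≤ k → Q env' mem') :
    Tri W X l (.forTo x y p) env mem Q := by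
  rintro ⟨⟨hx3, hx, hy⟩, hwp⟩ hW t ht s hs hm
  have hW' : p.bd X + (X + 1) ≤ W := hW
  set s₂ : State := ⟨Function.update (Function.update s.reg t (env x)) x 0, mem⟩ with hs₂
  have hloop := Exec.loop_rule (W := W) (b := .lt x y) (T := p.time l + 2) (N := l y)
    (p := .seq (p.compile (t + 1)) <| .seq (.instr (.const (t + 1) 1)) (.instr (.add x x (t + 1))))
    (fun k s' => s'.reg x = k ∧ s'.reg t = env x ∧ (∀ r, 10 ≤ r → r < t → s'.reg r = s.reg r) ∧
      ∃ env', env' x = env x ∧ (∀ r < 10, r ≠ x → s'.reg r = env' r) ∧ I k env' s'.mem)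
    ?_ (s := s₂) ?_
  · obtain ⟨k, s₃, τ₃, h₃, hτ₃, ⟨hxk, hrt, hf₃, env', hex, he', hI⟩, hb⟩ := hloop
    refine ⟨⟨Function.update s₃.reg x (env x), s₃.mem⟩, _, env',
      .seq (.instr _ _ (Nat.zero_le _)) <| .seq (.instr _ _ ?_) <|
      .seq (.instr _ _ (Nat.zero_le _)) <| .seq (s₁ := s₃) (t₁ := τ₃) ?_ <|
      .seq (t₂ := 1) (.instr _ _ (Nat.zero_le _)) ?_, ?_, ?_, ?_, ?_⟩
    · simp [Instr.value, Instr.exec, Function.update_of_ne (show x ≠ t by omega), hs x hx]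
      omega
    · convert h₃ using 1
      simp [hs₂, Instr.exec, Instr.value, hm, Function.update_of_ne (show x ≠ t by omega), hs x hx]
    · have hi := Exec.instr (W := W) (.add x x t) (Instr.exec (.const x 0) s₃) (by
        simp [Instr.value, Instr.exec, Function.update_of_ne (show t ≠ x by omega), hrt]
        omega)
      convert hi using 1
      simp [Instr.exec, Instr.value, Function.update_of_ne (show t ≠ x by omega), hrt]
    · simp only [Stmt.time]
      have h5 : p.time l + 2 + 1 = p.time l + 3 := by omega
      rw [h5] at hτ₃
      omega
    · intro r hr
      by_cases hrx : r = x
      · subst hrx; simp [hex]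
      · simp only [Function.update_of_ne hrx, he' r hr hrx]
    · intro r hr hrt
      simp only [Function.update_of_ne (show r ≠ x by omega), hf₃ r hr hrt]
    · refine hQ k _ _ hI ?_
      simp only [Test.Holds, hxk, he' y (by omega) (by omega)] at hb
      omega
  · rintro k s' ⟨hxk, hrt, hf', env', hex, he', hI⟩ hb
    have hky : k < env' y := by
      simpa only [Test.Holds, hxk, he' y (by omega) (by omega)] using hb
    obtain ⟨⟨hyl, hyX⟩, hT⟩ := hstep k env' s'.mem hI hex hky
    refine ⟨by omega, ?_⟩
    obtain ⟨s₄, τ₄, env₄, h₄, hτ₄, hr₄, hf₄, hxk₄, hI₄⟩ := hT hwp (by omega) (t + 1) (by omega) s' (by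
        intro r hr
        by_cases hrx : r = x
        · subst hrx; simp [hxk]
        · rw [Function.update_of_ne hrx, he' r hr hrx]) rfl
    have hx4 : s₄.reg x = k := (hr₄ x hx).trans hxk₄
    refine ⟨_, _, .seq h₄ (.seq (.instr _ _ ?_) (.instr _ _ ?_)), by omega, ?_, ?_, ?_,
      Function.update env₄ x (env x), by simp, ?_, hI₄⟩
    · simp only [Instr.value]; omega
    · simp only [Instr.value, Instr.exec, Function.update_self,
        Function.update_of_ne (show x ≠ t + 1 by omega), hx4]
      omega
    · simp only [Instr.value, Instr.exec, Function.update_self,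
        Function.update_of_ne (show x ≠ t + 1 by omega), hx4]
    · simp only [Instr.exec, Function.update_of_ne (show t ≠ x by omega),
        Function.update_of_ne (show t ≠ t + 1 by omega)]
      rw [hf₄ t ht (by omega), hrt]
    · intro r hr hrt
      simp only [Instr.exec, Function.update_of_ne (show r ≠ x by omega),
        Function.update_of_ne (show r ≠ t + 1 by omega)]
      rw [hf₄ r hr (by omega), hf' r hr hrt]
    · intro r hr hrx
      simp only [Instr.exec, Function.update_of_ne hrx,
        Function.update_of_ne (show r ≠ t + 1 by omega), hr₄ r hr]
  · refine ⟨by simp [hs₂], ?_, ?_, env, rfl, ?_, h0⟩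
    · simp [hs₂, Function.update_of_ne (show t ≠ x by omega)]
    · intro r hr hrt
      simp [hs₂, Function.update_of_ne (show r ≠ x by omega), Function.update_of_ne (show r ≠ t by omega)]
    · intro r hr hrx
      simp [hs₂, Function.update_of_ne hrx, Function.update_of_ne (show r ≠ t by omega), hs r hr]

end Language

end FloodIt

namespace FloodIt

/-! ### Counting connected sets -/

section Counting

variable {V : Type*} [Finite V] {G : SimpleGraph V}

/-- Growing a connected set from `a` one vertex at a time passes through every size. -/
theorem exists_connected_of_ncard {A : Set V} (hA : (G.induce A).Connected) {a : V} (ha : a ∈ A) :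
    ∀ s, 1 ≤ s → s ≤ A.ncard → ∃ D ⊆ A, (G.induce D).Connected ∧ a ∈ D ∧ D.ncard = s := by
  refine connected_induction hA (P := fun B => ∀ s, 1 ≤ s → s ≤ B.ncard →
    ∃ D ⊆ B, (G.induce D).Connected ∧ a ∈ D ∧ D.ncard = s) ha ?_ ?_
  · intro s h1 h2
    rw [Set.ncard_singleton] at h2
    exact ⟨{a}, le_rfl, connected_singleton a, rfl, by rw [Set.ncard_singleton]; omega⟩
  · intro B _ hB haB ih b hb x _ hxB hbx s h1 h2
    rcases h2.lt_or_eq with h | h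
    · rw [Set.ncard_insert_of_notMem hxB] at h
      obtain ⟨D, hD, h⟩ := ih s h1 (by omega)
      exact ⟨D, hD.trans (Set.subset_insert _ _), h⟩
    · exact ⟨_, le_rfl, connected_insert hB hb hbx, Set.mem_insert_of_mem _ haB, h.symm⟩

/-- Grow `A` vertex by vertex. When it reaches `s` vertices by adding `x`, there is a new connected
subset through `x` of each size from `1` to `s`; the total is at least `1 + 2 + ⋯ + A.ncard`. -/
theorem ncard_connected_subsets {A : Set V} (hA : (G.induce A).Connected) :
    A.ncard * (A.ncard + 1) ≤ 2 * {D | D ⊆ A ∧ (G.induce D).Connected}.ncard := by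
  obtain ⟨⟨a, ha⟩⟩ := hA.nonempty
  refine connected_induction hA (P := fun B =>
    B.ncard * (B.ncard + 1) ≤ 2 * {D | D ⊆ B ∧ (G.induce D).Connected}.ncard) ha ?_ ?_
  · have : 0 < {D | D ⊆ {a} ∧ (G.induce D).Connected}.ncard :=
      (Set.ncard_pos (Set.toFinite _)).2 ⟨{a}, le_rfl, connected_singleton a⟩
    rw [Set.ncard_singleton]
    omega
  · intro B _ hB _ ih b hb x _ hxB hbx
    have hB' := connected_insert hB hb hbx
    set T : Set (Set V) := {D | (D ⊆ insert x B ∧ (G.induce D).Connected) ∧ x ∈ D} with hT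
    have h1 : B.ncard + 1 ≤ T.ncard := by
      have hsub : Set.Icc 1 (B.ncard + 1) ⊆ Set.ncard '' T := by
        intro s hs
        obtain ⟨D, hD, hDc, hxD, hDs⟩ := exists_connected_of_ncard hB' (Set.mem_insert x B) s hs.1
          (by rw [Set.ncard_insert_of_notMem hxB]; exact hs.2)
        exact ⟨D, ⟨⟨hD, hDc⟩, hxD⟩, hDs⟩
      have h2 := Set.ncard_le_ncard hsub (Set.toFinite _)
      have h3 : (Set.Icc 1 (B.ncard + 1)).ncard = B.ncard + 1 := by
        rw [← Finset.coe_Icc, Set.ncard_coe_finset, Nat.card_Icc]; omega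
      exact h3 ▸ h2.trans (Set.ncard_image_le (Set.toFinite _))
    have hdis : Disjoint {D | D ⊆ B ∧ (G.induce D).Connected} T :=
      Set.disjoint_left.2 fun D hD hD' => hxB (hD.1 hD'.2)
    have hun : {D | D ⊆ B ∧ (G.induce D).Connected} ∪ T ⊆
        {D | D ⊆ insert x B ∧ (G.induce D).Connected} := by
      rintro D (hD | hD)
      exacts [⟨hD.1.trans (Set.subset_insert _ _), hD.2⟩, hD.1]
    have h4 := Set.ncard_le_ncard hun (Set.toFinite _)
    rw [Set.ncard_union_eq hdis (Set.toFinite _) (Set.toFinite _)] at h4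
    rw [Set.ncard_insert_of_notMem hxB]
    nlinarith

theorem sq_le_numConnected {n : ℕ} {G : SimpleGraph (Fin n)} (hG : G.Connected) :
    n * (n + 1) ≤ 2 * numConnected G := by
  have h := ncard_connected_subsets ((SimpleGraph.induceUnivIso G).connected_iff.2 hG)
  simpa [numConnected, Set.ncard_univ] using h

end Counting

/-! ### Enumerating connected sets -/

section Enumeration

variable {n : ℕ} {G : SimpleGraph (Fin n)} {m : ℕ} {S : ℕ → Finset (Fin n)}

/-- `S 0, …, S (m - 1)` are distinct connected sets, in order of size. -/
structure ConnList (G : SimpleGraph (Fin n)) (m : ℕ) (S : ℕ → Finset (Fin n)) : Prop where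
  conn : ∀ j < m, (G.induce (S j : Set (Fin n))).Connected
  inj : ∀ i < m, ∀ j < m, S i = S j → i = j
  sorted : ∀ j < m, ∀ i ≤ j, (S i).card ≤ (S j).card

/-- `S 0, …, S (m - 1)` are all connected sets, in order of size. -/
structure Enum (G : SimpleGraph (Fin n)) (m : ℕ) (S : ℕ → Finset (Fin n)) : Prop
    extends ConnList G m S where
  complete : ∀ A : Finset (Fin n), (G.induce (A : Set (Fin n))).Connected → ∃ j < m, S j = A

/-- A stage of the search: the sets before the `i`-th have been extended in all ways, the `i`-th one
by vertices below `v`. -/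
structure Search (G : SimpleGraph (Fin n)) (i v m : ℕ) (S : ℕ → Finset (Fin n)) : Prop
    extends ConnList G m S where
  single : ∀ v, ∃ j < m, S j = {v}
  near : i < m → ∀ j < m, (S j).card ≤ (S i).card + 1
  closed : ∀ i' < m, ∀ v' : Fin n, i' < i ∨ i' = i ∧ (v' : ℕ) < v → (∃ u ∈ S i', G.Adj u v') →
    ∃ j < m, S j = insert v' (S i')

theorem ConnList.le_numConnected (h : ConnList G m S) : m ≤ numConnected G := by
  have hinj : Set.InjOn (fun j => (S j : Set (Fin n))) (Finset.range m : Set ℕ) := by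
    intro i hi j hj hij
    simp only [Finset.coe_range, Set.mem_Iio] at hi hj
    exact h.inj i hi j hj (Finset.coe_injective hij)
  have h1 := hinj.ncard_image
  rw [Set.ncard_coe_finset, Finset.card_range] at h1
  rw [← h1]
  refine Set.ncard_le_ncard ?_ (Set.toFinite _)
  rintro _ ⟨j, hj, rfl⟩
  exact h.conn j (by simpa using hj)

theorem Search.init (S : ℕ → Finset (Fin n)) (hS : ∀ v : Fin n, S v = {v}) : Search G 0 0 n S where
  conn j hj := by
    have := hS ⟨j, hj⟩
    simp only at this
    rw [this, Finset.coe_singleton]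
    exact connected_singleton _
  inj i hi j hj hij := by
    have h1 := hS ⟨i, hi⟩
    have h2 := hS ⟨j, hj⟩
    simp only at h1 h2
    rw [h1, h2] at hij
    simpa using hij
  sorted j hj i hi := by
    have h1 := hS ⟨i, hi.trans_lt hj⟩
    have h2 := hS ⟨j, hj⟩
    simp only at h1 h2
    rw [h1, h2, Finset.card_singleton, Finset.card_singleton]
  single v := ⟨v, v.2, hS v⟩
  near h j hj := by
    have h2 := hS ⟨j, hj⟩
    simp only at h2
    rw [h2, Finset.card_singleton]
    omega
  closed i' _ v' h := by omega

theorem Search.skip {i v : ℕ} (h : Search G i v m S) (hv : v < n)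
    (hf : (∃ u ∈ S i, G.Adj u ⟨v, hv⟩) → ∃ j < m, S j = insert ⟨v, hv⟩ (S i)) :
    Search G i (v + 1) m S where
  toConnList := h.toConnList
  single := h.single
  near := h.near
  closed i' hi' v' hlt hadj := by
    by_cases hc : i' = i ∧ (v' : ℕ) = v
    · obtain ⟨rfl, rfl⟩ := hc
      exact hf hadj
    · exact h.closed i' hi' v' (by omega) hadj

/-- The new set has one element more than `S i`, and by `near` no listed set is larger than that, so
the list stays sorted when it is put at the end. -/
theorem Search.append {i v : ℕ} (h : Search G i v m S) (hi : i < m) (hv : v < n)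
    (hadj : ∃ u ∈ S i, G.Adj u ⟨v, hv⟩) (hnew : ∀ j < m, S j ≠ insert ⟨v, hv⟩ (S i)) :
    Search G i (v + 1) (m + 1) (Function.update S m (insert ⟨v, hv⟩ (S i))) := by
  set A := insert (⟨v, hv⟩ : Fin n) (S i) with hA
  have hlt : ∀ j < m, Function.update S m A j = S j := fun j hj =>
    Function.update_of_ne (by omega) _ _
  have hm : Function.update S m A m = A := Function.update_self _ _ _
  have hvS : (⟨v, hv⟩ : Fin n) ∉ S i := fun hmem => hnew i hi (Finset.insert_eq_of_mem hmem).symm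
  have hcard : A.card = (S i).card + 1 := Finset.card_insert_of_notMem hvS
  constructor
  · constructor
    · intro j hj
      rcases Nat.lt_succ_iff_lt_or_eq.1 hj with hj | rfl
      · rw [hlt j hj]; exact h.conn j hj
      · rw [hm, hA, Finset.coe_insert]
        obtain ⟨u, hu, huv⟩ := hadj
        exact connected_insert (h.conn i hi) hu huv
    · intro a ha b hb hab
      rcases Nat.lt_succ_iff_lt_or_eq.1 ha with ha | rfl <;>
        rcases Nat.lt_succ_iff_lt_or_eq.1 hb with hb | rfl
      · rw [hlt a ha, hlt b hb] at hab; exact h.inj a ha b hb hab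
      · rw [hlt a ha, hm] at hab; exact absurd hab (hnew a ha)
      · rw [hlt b hb, hm] at hab; exact absurd hab.symm (hnew b hb)
      · rfl
    · intro b hb a ha
      rcases Nat.lt_succ_iff_lt_or_eq.1 hb with hb | rfl
      · rw [hlt a (by omega), hlt b hb]; exact h.sorted b hb a ha
      · rcases ha.lt_or_eq with ha | rfl
        · rw [hlt a ha, hm, hcard]; exact h.near hi a ha
        · rfl
  · intro w
    obtain ⟨j, hj, hjw⟩ := h.single w
    exact ⟨j, by omega, by rw [hlt j hj, hjw]⟩
  · intro _ j hj
    rw [hlt i hi]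
    rcases Nat.lt_succ_iff_lt_or_eq.1 hj with hj | rfl
    · rw [hlt j hj]; exact h.near hi j hj
    · rw [hm, hcard]
  · intro i' hi' v' hlt' hadj'
    have hi'm : i' < m := by omega
    rw [hlt i' hi'm] at hadj' ⊢
    by_cases hc : i' = i ∧ (v' : ℕ) = v
    · obtain ⟨rfl, rfl⟩ := hc
      exact ⟨m, by omega, hm⟩
    · obtain ⟨j, hj, hjA⟩ := h.closed i' hi'm v' (by omega) hadj'
      exact ⟨j, by omega, by rw [hlt j hj, hjA]⟩

theorem Search.next {i : ℕ} (h : Search G i n m S) : Search G (i + 1) 0 m S where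
  toConnList := h.toConnList
  single := h.single
  near hi j hj := (h.near (by omega) j hj).trans (by have := h.sorted (i + 1) hi i (by omega); omega)
  closed i' hi' v' hlt hadj := h.closed i' hi' v' (by have := v'.2; omega) hadj

/-- The list contains the singletons and is closed under adding an adjacent vertex, so
`connected_induction` reaches every connected set. -/
theorem Search.finish {i : ℕ} (h : Search G i 0 m S) (hi : m ≤ i) : Enum G m S where
  toConnList := h.toConnList
  complete A hA := by
    obtain ⟨⟨a, ha⟩⟩ := hA.nonempty
    have := connected_induction hA (P := fun B => ∃ j < m, (S j : Set (Fin n)) = B) ha ?_ ?_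
    · obtain ⟨j, hj, hjA⟩ := this
      exact ⟨j, hj, Finset.coe_injective hjA⟩
    · obtain ⟨j, hj, hja⟩ := h.single a
      exact ⟨j, hj, by rw [hja, Finset.coe_singleton]⟩
    · rintro B _ _ _ ⟨j, hj, rfl⟩ b hb x _ _ hbx
      obtain ⟨k, hk, hkx⟩ := h.closed j hj x (by omega) ⟨b, hb, hbx⟩
      exact ⟨k, hk, by rw [hkx, Finset.coe_insert]⟩

theorem Enum.pos (h : Enum G m S) (hG : G.Connected) : 0 < m := by
  obtain ⟨j, hj, -⟩ := h.complete Finset.univ (by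
    rw [Finset.coe_univ]; exact (SimpleGraph.induceUnivIso G).connected_iff.2 hG)
  omega

theorem Enum.last (h : Enum G m S) (hG : G.Connected) : S (m - 1) = Finset.univ := by
  obtain ⟨j, hj, hju⟩ := h.complete Finset.univ (by
    rw [Finset.coe_univ]; exact (SimpleGraph.induceUnivIso G).connected_iff.2 hG)
  have := h.sorted (m - 1) (by omega) j (by omega)
  rw [hju] at this
  exact (Finset.card_eq_iff_eq_univ _).1 (le_antisymm (Finset.card_le_univ _) this)

end Enumeration

/-! ### The recursion -/

section Recursion

variable {n c : ℕ} {G : SimpleGraph (Fin n)} {ω : Fin n → Fin c} {m : ℕ} {S : ℕ → Finset (Fin n)}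
  {T : ℕ → ℕ → ℕ}

/-- The cost for the `j`-th set and colour `d`, from the table `T` of costs without a final
recolouring. -/
def cost (T : ℕ → ℕ → ℕ) (c j d : ℕ) : ℕ := foldUpTo true (T j d) (fun d' => 1 + T j d') c

theorem cost_le {j d z : ℕ} : cost T c j d ≤ z ↔ T j d ≤ z ∨ ∃ d' < c, 1 + T j d' ≤ z :=
  foldUpTo_true_le _ _ _ _

/-- The number of vertices of `A` of a colour other than `d`. -/
def wrong (ω : Fin n → Fin c) (A : Finset (Fin n)) (d : ℕ) : ℕ := (A.filter fun v => (ω v : ℕ) ≠ d).card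

/-- The recursion for the table. -/
def Recursion (ω : Fin n → Fin c) (m : ℕ) (S : ℕ → Finset (Fin n)) (T : ℕ → ℕ → ℕ) (j d : ℕ) : Prop :=
  ∀ z, T j d ≤ z ↔ wrong ω (S j) d ≤ z ∨ ∃ a < m, ∃ b < m, Disjoint (S a) (S b) ∧ S a ∪ S b = S j ∧
    cost T c a d + cost T c b d ≤ z

/-- Induction on the derivation: both parts of a merge are connected, hence listed, and the
recursion has considered this pair. -/
theorem cost_le_of_der (hS : Enum G m S) (hT : ∀ j < m, ∀ d < c, Recursion ω m S T j d)
    {A : Set (Fin n)} {d : Fin c} {k : ℕ} (h : Der G id ω A d k) {j : ℕ} (hj : j < m)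
    (hjA : (S j : Set (Fin n)) = A) : cost T c j d ≤ k := by
  classical
  induction h generalizing j with
  | leaf v =>
    refine cost_le.2 (Or.inl ((hT j hj _ (ω v).2 0).2 (Or.inl ?_)))
    rw [wrong, Nat.le_zero, Finset.card_eq_zero, Finset.filter_eq_empty_iff]
    intro x hx
    have : x ∈ (S j : Set (Fin n)) := hx
    rw [hjA] at this
    have : x = v := this
    simp [this]
  | @recol A d k d' h ih =>
    rcases cost_le.1 (ih hj hjA) with h | ⟨e, he, h⟩
    · exact cost_le.2 (Or.inr ⟨d, d.2, by omega⟩)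
    -- Of two recolourings in a row only the last matters, so one final recolouring is enough in
    -- `cost`.
    · exact cost_le.2 (Or.inr ⟨e, he, by omega⟩)
  | @merge A B d k l hA hB hd he ihA ihB =>
    obtain ⟨a, ha, haA⟩ := hS.complete A.toFinset (by rw [Set.coe_toFinset]; exact hA.connected)
    obtain ⟨b, hb, hbB⟩ := hS.complete B.toFinset (by rw [Set.coe_toFinset]; exact hB.connected)
    have h1 := ihA ha (by rw [haA, Set.coe_toFinset])
    have h2 := ihB hb (by rw [hbB, Set.coe_toFinset])
    refine cost_le.2 (Or.inl ((hT j hj _ d.2 _).2 (Or.inr ⟨a, ha, b, hb, ?_, ?_, add_le_add h1 h2⟩)))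
    · rw [haA, hbB, Set.disjoint_toFinset]; exact hd
    · rw [haA, hbB]; apply Finset.coe_injective; simp [hjA]

/-- The value `wrong` is attained by recolouring single vertices (`Der.of_connected`); a value
coming from a pair is attained by merging derivations of two smaller sets. -/
theorem der_cost (hS : Enum G m S) (hT : ∀ j < m, ∀ d < c, Recursion ω m S T j d) {j : ℕ}
    (hj : j < m) (d : Fin c) : Der G id ω (S j : Set (Fin n)) d (cost T c j d) := by
  classical
  induction hk : (S j).card using Nat.strong_induction_on generalizing j d with
  | _ k ih =>
    have hTd : ∀ d : Fin c, Der G id ω (S j : Set (Fin n)) d (T j d) := by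
      intro d
      rcases (hT j hj d d.2 _).1 le_rfl with h | ⟨a, ha, b, hb, hab, habj, h⟩
      · have h1 := (hT j hj d d.2 _).2 (Or.inl le_rfl)
        rw [le_antisymm h1 h]
        convert Der.of_connected (ω := ω) (hS.conn j hj) d using 1
        rw [wrong]
        congr 1
        ext v
        simp [Fin.ext_iff]
      · have h1 := (hT j hj d d.2 _).2 (Or.inr ⟨a, ha, b, hb, hab, habj, le_rfl⟩)
        rw [le_antisymm h1 h]
        have hcard : (S a).card + (S b).card = (S j).card := by
          rw [← Finset.card_union_of_disjoint hab, habj]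
        have hna : (S a).Nonempty := by
          obtain ⟨⟨x, hx⟩⟩ := (hS.conn a ha).nonempty; exact ⟨x, hx⟩
        have hnb : (S b).Nonempty := by
          obtain ⟨⟨x, hx⟩⟩ := (hS.conn b hb).nonempty; exact ⟨x, hx⟩
        have hpa := hna.card_pos
        have hpb := hnb.card_pos
        have hab' : Disjoint (S a : Set (Fin n)) (S b) := Finset.disjoint_coe.2 hab
        have hj' : (S j : Set (Fin n)) = (S a : Set (Fin n)) ∪ (S b : Set (Fin n)) := by rw [← habj, Finset.coe_union]
        -- The two parts of a connected set are automatically joined by an edge, so the recursion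
        -- need not test adjacency.
        obtain ⟨x, hx, y, hy, hyx, hxy⟩ := exists_adj_of_ssubset (hS.conn j hj)
          (B := (S a : Set (Fin n))) (Finset.coe_nonempty.2 hna)
          (by rw [hj']; exact Set.subset_union_left) (by
            intro heq
            have := Finset.coe_injective heq
            rw [this] at hcard
            omega)
        have hy : y ∈ (S a : Set (Fin n)) ∪ S b := hj' ▸ hy
        rw [hj']
        exact (ih _ (by omega) ha d rfl).merge (ih _ (by omega) hb d rfl) hab'
          ⟨x, hx, y, hy.resolve_left hyx, hxy⟩
    rcases cost_le.1 (le_refl (cost T c j d)) with h | ⟨e, he, h⟩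
    · rw [le_antisymm (cost_le.2 (Or.inl le_rfl)) h]
      exact hTd d
    · rw [le_antisymm (cost_le.2 (Or.inr ⟨e, he, le_rfl⟩)) h, add_comm]
      exact (hTd ⟨e, he⟩).recol d

theorem cost_eq_minMovesTo (hG : G.Connected) (hS : Enum G m S)
    (hT : ∀ j < m, ∀ d < c, Recursion ω m S T j d) (d : Fin c) :
    (cost T c (m - 1) d : ℕ∞) = minMovesTo G ω d := by
  have hm := hS.pos hG
  have hu : (S (m - 1) : Set (Fin n)) = Set.univ := by rw [hS.last hG, Finset.coe_univ]
  refine (minMovesTo_eq hG ?_ ?_).symm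
  · rw [← hu]; exact der_cost hS hT (by omega) d
  · intro l hl
    exact cost_le_of_der hS hT hl (by omega) hu

theorem table_le (hT : ∀ j < m, ∀ d < c, Recursion ω m S T j d) {j d : ℕ} (hj : j < m) (hd : d < c) :
    T j d ≤ n :=
  (hT j hj d hd n).2 (Or.inl ((Finset.card_le_univ _).trans (by simp)))

theorem fold_cost_eq_minMoves (hG : G.Connected) (hS : Enum G m S)
    (hT : ∀ j < m, ∀ d < c, Recursion ω m S T j d) :
    (foldUpTo true n (cost T c (m - 1)) c : ℕ∞) = minMoves G ω := by
  have hm := hS.pos hG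
  have hle := foldUpTo_true_le n (cost T c (m - 1)) c
  obtain ⟨v⟩ := hG.nonempty
  have hd0 := (ω v).2
  unfold minMoves
  simp_rw [← cost_eq_minMovesTo hG hS hT]
  refine le_antisymm (le_iInf fun d => ?_) ?_
  · exact_mod_cast (hle _).2 (Or.inr ⟨d, d.2, le_rfl⟩)
  -- The starting value `n` of the minimum is harmless: there is a colour, and its cost is at most
  -- `n`.
  · rcases (hle _).1 le_rfl with h | ⟨d, hd, h⟩
    · refine (iInf_le _ (ω v)).trans ?_
      have : cost T c (m - 1) (ω v) ≤ n :=
        cost_le.2 (Or.inl (table_le hT (by omega) hd0))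
      exact_mod_cast this.trans h
    · refine (iInf_le _ ⟨d, hd⟩).trans ?_
      exact_mod_cast h

/-- The four terms vanish when, respectively, `A` and `B` are disjoint, `A ⊆ C`, `B ⊆ C`, and `C` is
no larger than `A` and `B` together. Only intersection sizes occur, so the test takes constant time
from a table. -/
theorem defect_eq_zero_iff {A B C : Finset (Fin n)} :
    (A ∩ B).card + ((A ∩ A).card - (A ∩ C).card) + ((B ∩ B).card - (B ∩ C).card) +
      ((C ∩ C).card - ((A ∩ A).card + (B ∩ B).card)) = 0 ↔ Disjoint A B ∧ A ∪ B = C := by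
  simp only [Finset.inter_self, Nat.add_eq_zero_iff, Finset.card_eq_zero, Nat.sub_eq_zero_iff_le,
    ← Finset.disjoint_iff_inter_eq_empty]
  constructor
  · rintro ⟨⟨⟨h1, h2⟩, h3⟩, h4⟩
    have hA := Finset.inter_eq_left.1 (Finset.eq_of_subset_of_card_le Finset.inter_subset_left h2)
    have hB := Finset.inter_eq_left.1 (Finset.eq_of_subset_of_card_le Finset.inter_subset_left h3)
    refine ⟨h1, Finset.eq_of_subset_of_card_le (Finset.union_subset hA hB) ?_⟩
    rwa [Finset.card_union_of_disjoint h1]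
  · rintro ⟨h1, rfl⟩
    refine ⟨⟨⟨h1, ?_⟩, ?_⟩, (Finset.card_union_le _ _)⟩
    · rw [Finset.inter_eq_left.2 Finset.subset_union_left]
    · rw [Finset.inter_eq_left.2 Finset.subset_union_right]

end Recursion

end FloodIt

namespace FloodIt

/-! ### The program -/

section Program

open Ex Stmt

/-- `1` if `e` is zero, and `0` otherwise. -/
def isZero (e : Ex) : Ex := .sub (.const 1) e

def dist (a b : Ex) : Ex := .add (.sub a b) (.sub b a)

/-- The first address after the input and the output. -/
def bitBase : Ex := .add (.add (.add (.var 0) (.mul (.var 0) (.var 0))) (.var 1)) (.const 1)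

/-- The address of the bit that says whether vertex `u` is in the `j`-th set. -/
def bitAddr (j u : Ex) : Ex := .add (.add bitBase (.mul j (.var 0))) u

def bit (j u : Ex) : Ex := .load (bitAddr j u)

/-- The additional row after the `var 2` sets is where the search writes its candidates; it may
still contain a rejected one. -/
def interBase : Ex := .add bitBase (.mul (.add (.var 2) (.const 1)) (.var 0))

/-- The address of the size of the intersection of the `i`-th and the `j`-th set. -/
def interAddr (i j : Ex) : Ex := .add (.add interBase (.mul i (.var 2))) j

def inter (i j : Ex) : Ex := .load (interAddr i j)

def tableBase : Ex := .add interBase (.mul (.var 2) (.var 2))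

/-- The address of the table entry for the `j`-th set and colour `d`. -/
def tableAddr (j d : Ex) : Ex := .add (.add tableBase (.mul j (.var 1))) d

def costEx (j d : Ex) : Ex :=
  .fold true 7 1 (.load (tableAddr j d)) (.add (.const 1) (.load (tableAddr j (.var 7))))

/-- Zero if and only if the set with index `var 3` is the disjoint union of those with indices `var 5`
and `var 6`. -/
def defect : Ex :=
  .add (.add (.add (inter (.var 5) (.var 6)) (.sub (inter (.var 5) (.var 5)) (inter (.var 5) (.var 3))))
    (.sub (inter (.var 6) (.var 6)) (inter (.var 6) (.var 3))))
    (.sub (inter (.var 3) (.var 3)) (.add (inter (.var 5) (.var 5)) (inter (.var 6) (.var 6))))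

/-- Write the singletons. -/
def initStmt : Stmt :=
  .seq (.forTo 3 0 (.put (bitAddr (.var 3) (.var 3)) (.const 1))) (.set 2 (.var 0))

/-- Write the set with index `var 3`, with the vertex `var 4` added, to the end of the list. -/
def copyStmt : Stmt :=
  .forTo 5 0 (.put (bitAddr (.var 2) (.var 5))
    (isZero (.mul (isZero (bit (.var 3) (.var 5))) (dist (.var 5) (.var 4)))))

/-- The new number of sets. -/
def countEx : Ex :=
  .add (.var 2) (.mul
    -- The double `isZero` turns the number of neighbours of `var 4` in the set into `0` or `1`. The
    -- second factor is `1` when no listed set agrees with the candidate row, and the product acts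
    -- as a conjunction.
    (isZero (isZero (.fold false 5 0 (.const 0)
      (.mul (bit (.var 3) (.var 5)) (.load (.add (.add (.var 0) (.mul (.var 0) (.var 5))) (.var 4)))))))
    (isZero (.fold false 6 2 (.const 0)
      (isZero (.fold false 5 0 (.const 0) (dist (bit (.var 6) (.var 5)) (bit (.var 2) (.var 5))))))))

/-- The list is its own queue: the outer limit `var 2` is the current length. Every candidate is
written behind the list, and it becomes part of it only if the length is increased. -/
def searchStmt : Stmt := .forTo 3 2 (.forTo 4 0 (.seq copyStmt (.set 2 countEx)))

def interEx : Ex := .fold false 5 0 (.const 0) (.mul (bit (.var 3) (.var 5)) (bit (.var 4) (.var 5)))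

def interStmt : Stmt := .forTo 3 2 (.forTo 4 2 (.put (interAddr (.var 3) (.var 4)) interEx))

def wrongEx : Ex :=
  .fold false 6 0 (.const 0)
    (.mul (bit (.var 3) (.var 6)) (isZero (isZero (dist (.load (.var 6)) (.var 4)))))

/-- Pairs that do not partition the set are penalised by a multiple of `n + 1`. As `wrongEx` never
exceeds `n`, neither they nor the inner starting value `n + 1` can win. -/
def tableEx : Ex :=
  .fold true 5 2 wrongEx (.fold true 6 2 (.add (.var 0) (.const 1))
    (.add (.add (costEx (.var 5) (.var 4)) (costEx (.var 6) (.var 4)))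
      (.mul (.add (.var 0) (.const 1)) defect)))

def tableStmt : Stmt := .forTo 3 2 (.forTo 4 1 (.put (tableAddr (.var 3) (.var 4)) tableEx))

def outEx : Ex := costEx (.sub (.var 2) (.const 1)) (.var 3)

def outStmt : Stmt :=
  .seq (.forTo 3 1 (.put (.var 3) outEx)) (.put (.var 1) (.fold true 3 1 (.var 0) outEx))

def floodStmt : Stmt :=
  .seq initStmt <| .seq searchStmt <| .seq interStmt <| .seq tableStmt outStmt

theorem floodStmt_wf : floodStmt.Wf := by
  simp [floodStmt, initStmt, searchStmt, interStmt, tableStmt, outStmt, Stmt.Wf, Ex.Wf, copyStmt,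
    countEx, interEx, wrongEx, tableEx, outEx, costEx, defect, inter, interAddr, bit, bitAddr, bitBase,
    interBase, tableBase, tableAddr, isZero, dist]

/-- The variables outside of loops. -/
def vars (n c m : ℕ) (r : ℕ) : ℕ := if r = 0 then n else if r = 1 then c else if r = 2 then m else 0

/-- The largest terms are `c ^ 2 * N ^ 3` from the table of costs and `n ^ 2 * N ^ 2` from comparing
candidates with the list. The latter needs `n ^ 2 ≤ 2 * N`. The constant is generous. -/
theorem floodStmt_time {n c N : ℕ} (hn : 1 ≤ n) (hc : 1 ≤ c) (hN : n * (n + 1) ≤ 2 * N) :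
    floodStmt.time (vars n c N) ≤ 100000 * (c ^ 3 * N ^ 3) := by
  simp [floodStmt, initStmt, searchStmt, interStmt, tableStmt, outStmt, Stmt.time, Ex.time, copyStmt,
    countEx, interEx, wrongEx, tableEx, outEx, costEx, defect, inter, interAddr, bit, bitAddr, bitBase,
    interBase, tableBase, tableAddr, isZero, dist, vars]
  have hnN : n ≤ N := by nlinarith
  have hN1 : 1 ≤ N := hn.trans hnN
  have hsq : n ^ 2 ≤ 2 * N := by nlinarith
  -- Each monomial of the running time is compared with the leading one; after `ring_nf` they are
  -- atoms, and `omega` adds up linearly.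
  have key : ∀ a b, a ≤ 3 → b ≤ 3 → N ^ a * c ^ b ≤ N ^ 3 * c ^ 3 := fun a b ha hb =>
    Nat.mul_le_mul (Nat.pow_le_pow_right hN1 ha) (Nat.pow_le_pow_right hc hb)
  have h00 := key 0 0 (by norm_num) (by norm_num)
  have h10 := key 1 0 (by norm_num) (by norm_num)
  have h20 := key 2 0 (by norm_num) (by norm_num)
  have h30 := key 3 0 (by norm_num) (by norm_num)
  have h11 := key 1 1 (by norm_num) (by norm_num)
  have h21 := key 2 1 (by norm_num) (by norm_num)
  have h31 := key 3 1 (by norm_num) (by norm_num)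
  have h32 := key 3 2 (by norm_num) (by norm_num)
  have h01 := key 0 1 (by norm_num) (by norm_num)
  have h02 := key 0 2 (by norm_num) (by norm_num)
  simp only [pow_zero, mul_one, one_mul, pow_one] at h00 h10 h20 h30 h11 h21 h31 h32 h01 h02
  have e1 : n * N ≤ N ^ 2 := by rw [sq]; exact Nat.mul_le_mul_right _ hnN
  have e2 : n * N * c ≤ N ^ 2 * c := Nat.mul_le_mul_right _ e1
  have e3 : n * N ^ 2 ≤ N ^ 3 := by rw [pow_succ' N 2]; exact Nat.mul_le_mul_right _ hnN
  have e4 : n ^ 2 * N ≤ 2 * N ^ 2 := by nlinarith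
  have e5 : n ^ 2 * N ^ 2 ≤ 2 * N ^ 3 := by
    have := Nat.mul_le_mul_right (N ^ 2) hsq
    nlinarith
  ring_nf
  omega

end Program

end FloodIt

namespace FloodIt

/-! ### Rules for loops that only write to memory -/

section Rules

variable {W X : ℕ} {l : ℕ → ℕ} {env mem : ℕ → ℕ} {Q : (ℕ → ℕ) → (ℕ → ℕ) → Prop}

theorem Tri.forMem {x y : ℕ} {p : Stmt} (hy3 : y < 3) (hok : Ok X l env mem)
    (I : ℕ → (ℕ → ℕ) → Prop) (h0 : I 0 mem)
    (hstep : ∀ k < env y, ∀ mem', I k mem' → Tri W X l p (Function.update env x k) mem'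
      fun env'' mem'' => env'' = Function.update env x k ∧ I (k + 1) mem'')
    (hQ : ∀ mem', I (env y) mem' → Q env mem') : Tri W X l (.forTo x y p) env mem Q := by
  refine Tri.forTo (fun k env' mem' => env' = env ∧ k ≤ env y ∧ I k mem') (hok.env_le x)
    ⟨rfl, Nat.zero_le _, h0⟩ ?_ ?_
  · rintro k env' mem' ⟨rfl, hk, hI⟩ - hlt
    refine ⟨⟨hok.lim_le y hy3, hok.env_le y⟩, (hstep k hlt mem' hI).mono ?_⟩
    rintro env'' mem'' ⟨rfl, hI'⟩
    exact ⟨by simp, by simp, hlt, hI'⟩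
  · rintro k env' mem' ⟨rfl, hk, hI⟩ hle
    obtain rfl : k = env' y := le_antisymm hk hle
    exact hQ mem' hI

theorem row_eq_iff {w i j u v : ℕ} (hu : u < w) (hv : v < w) :
    i * w + u = j * w + v ↔ i = j ∧ u = v := by
  constructor
  · intro h
    have h1 : (i * w + u) / w = i := by
      rw [mul_comm, Nat.mul_add_div (by omega), Nat.div_eq_of_lt hu, add_zero]
    have h2 : (j * w + v) / w = j := by
      rw [mul_comm, Nat.mul_add_div (by omega), Nat.div_eq_of_lt hv, add_zero]
    obtain rfl : i = j := by rw [← h1, ← h2, h]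
    exact ⟨rfl, by omega⟩
  · rintro ⟨rfl, rfl⟩; rfl

theorem row_lt {w h i u : ℕ} (hi : i < h) (hu : u < w) : i * w + u < h * w := by
  have : (i + 1) * w ≤ h * w := Nat.mul_le_mul_right _ hi
  rw [Nat.succ_mul] at this
  omega

theorem update_le {mem : ℕ → ℕ} (h : ∀ a, mem a ≤ X) {b z : ℕ} (hz : z ≤ X) (a : ℕ) :
    Function.update mem b z a ≤ X := by
  rw [Function.update_apply]; split_ifs; exacts [hz, h a]

/-- Filling a two-dimensional table row by row. -/
theorem Tri.fill {y z b : ℕ} {addr val : Ex} (hy : y < 3) (hz : z < 3) (hok : Ok X l env mem)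
    (D : ℕ → ℕ → (ℕ → ℕ) → Prop)
    (hstep : ∀ i < env y, ∀ j < env z, ∀ mem', (∀ a, mem' a ≤ X) → (∀ a < b, mem' a = mem a) →
      (∀ i' j', i' < env y → j' < env z → i' < i ∨ i' = i ∧ j' < j → D i' j' mem') →
      addr.eval (Function.update (Function.update env 3 i) 4 j) mem' = b + (i * env z + j) ∧
      val.eval (Function.update (Function.update env 3 i) 4 j) mem' ≤ X ∧
      ∀ i' j', i' < env y → j' < env z → i' < i ∨ i' = i ∧ j' < j + 1 → D i' j'
        (Function.update mem' (b + (i * env z + j))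
          (val.eval (Function.update (Function.update env 3 i) 4 j) mem')))
    (hQ : ∀ mem', (∀ a, mem' a ≤ X) → (∀ a < b, mem' a = mem a) →
      (∀ i < env y, ∀ j < env z, D i j mem') → Q env mem') :
    Tri W X l (.forTo 3 y (.forTo 4 z (.put addr val))) env mem Q := by
  refine Tri.forMem hy hok (fun i mem' => (∀ a, mem' a ≤ X) ∧ (∀ a < b, mem' a = mem a) ∧
    ∀ i' j', i' < env y → j' < env z → i' < i → D i' j' mem') ⟨hok.mem_le, fun _ _ => rfl, by omega⟩ ?_ ?_
  · rintro i hi mem₁ ⟨hle₁, hb₁, hD₁⟩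
    have hok₁ : Ok X l env mem₁ := ⟨hok.env_le, hle₁, hok.lim_le⟩
    have hok₃ := hok₁.update (x := 3) (k := i) le_rfl (hi.le.trans (hok.env_le y))
    have hz3 : Function.update env 3 i z = env z := Function.update_of_ne (by omega) _ _
    refine Tri.forMem hz hok₃ (fun j mem' => (∀ a, mem' a ≤ X) ∧
      (∀ a < b, mem' a = mem a) ∧ ∀ i' j', i' < env y → j' < env z → i' < i ∨ i' = i ∧ j' < j →
        D i' j' mem') ⟨hle₁, hb₁, fun i' j' h1 h2 h3 => hD₁ i' j' h1 h2 (by omega)⟩ ?_ ?_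
    · rintro j hj mem₂ ⟨hle₂, hb₂, hD₂⟩
      rw [hz3] at hj
      obtain ⟨ha, hv, hD⟩ := hstep i hi j hj mem₂ hle₂ hb₂ hD₂
      have hok₂ : Ok X l env mem₂ := ⟨hok.env_le, hle₂, hok.lim_le⟩
      refine Tri.put ((hok₂.update (x := 3) (k := i) le_rfl (hi.le.trans (hok.env_le y))).update
        (by omega) (hj.le.trans (hok.env_le z))) ⟨rfl, ?_, ?_, ?_⟩
      · exact update_le hle₂ hv
      · intro a hab
        rw [ha, Function.update_of_ne (by omega)]
        exact hb₂ a hab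
      · rw [ha]; exact hD
    · rintro mem' ⟨hle', hb', hD'⟩
      rw [hz3] at hD'
      exact ⟨rfl, hle', hb', fun i' j' h1 h2 h3 => hD' i' j' h1 h2 (by omega)⟩
  · rintro mem' ⟨hle', hb', hD'⟩
    exact hQ mem' hle' hb' fun i hi j hj => hD' i j hi hj hi

end Rules

/-! ### Correctness of the program -/

section Correctness

variable {n c N : ℕ} {G : SimpleGraph (Fin n)} {ω : Fin n → Fin c} {m : ℕ} {S : ℕ → Finset (Fin n)}
  {mem : ℕ → ℕ} {W : ℕ} {Q : (ℕ → ℕ) → (ℕ → ℕ) → Prop}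

/-- The first address after the input and the output. -/
def base (n c : ℕ) : ℕ := n + n * n + c + 1

/-- The memory holds the input. -/
def Input (G : SimpleGraph (Fin n)) (ω : Fin n → Fin c) (mem : ℕ → ℕ) : Prop :=
  ∀ a < base n c, mem a = (inputState G ω).mem a

open Classical in
/-- The memory holds the sets `S 0, …, S (m - 1)`. -/
def Bits (c m : ℕ) (S : ℕ → Finset (Fin n)) (mem : ℕ → ℕ) : Prop :=
  ∀ j < m, ∀ u : Fin n, mem (base n c + j * n + u) = if u ∈ S j then 1 else 0

structure Sizes (n c N : ℕ) : Prop where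
  pos_n : 1 ≤ n
  pos_c : 1 ≤ c
  le_N : n ≤ N

theorem Sizes.n_le (h : Sizes n c N) : n ≤ c * N :=
  h.le_N.trans (Nat.le_mul_of_pos_left _ h.pos_c)

theorem Sizes.one_le (h : Sizes n c N) : 1 ≤ c * N := h.pos_n.trans h.n_le

theorem Sizes.ok (h : Sizes n c N) (hm : m ≤ N) (hmem : ∀ a, mem a ≤ c * N) :
    Ok (c * N) (vars n c N) (vars n c m) mem where
  env_le r := by
    have h1 := h.n_le
    have h2 : c ≤ c * N := Nat.le_mul_of_pos_right _ (h.pos_n.trans h.le_N)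
    have h3 : N ≤ c * N := Nat.le_mul_of_pos_left _ h.pos_c
    unfold vars
    split_ifs <;> omega
  mem_le := hmem
  lim_le y hy := by
    unfold vars
    split_ifs <;> omega

theorem input_color (v : Fin n) : (inputState G ω).mem v = ω v := by
  simp [inputState]

open Classical in
theorem input_adj (u v : Fin n) :
    (inputState G ω).mem (n + n * u + v) = if G.Adj u v then 1 else 0 := by
  have h : ¬ n + n * (u : ℕ) + v < n := by omega
  simp only [inputState, dif_neg h]
  refine if_congr ⟨?_, fun h => ⟨u, v, rfl, h⟩⟩ rfl rfl
  rintro ⟨u', v', huv, h⟩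
  obtain ⟨h1, h2⟩ := (row_eq_iff u.2 u'.2 (i := u) (j := u')).1 (by
    have := (row_eq_iff v.2 v'.2 (i := u) (j := u')).1 (by rw [mul_comm (u : ℕ), mul_comm (u' : ℕ)]; omega)
    rw [this.1])
  have h3 := (row_eq_iff v.2 v'.2 (i := u) (j := u')).1 (by
    rw [mul_comm (u : ℕ), mul_comm (u' : ℕ)]; omega)
  rwa [Fin.ext h3.1, Fin.ext h3.2]

theorem input_eq_zero {a : ℕ} (ha : base n c ≤ a) : (inputState G ω).mem a = 0 := by
  have h : ¬ a < n := by unfold base at ha; omega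
  simp only [inputState, dif_neg h]
  rw [if_neg]
  rintro ⟨u, v, rfl, -⟩
  have := row_lt u.2 v.2
  unfold base at ha
  rw [mul_comm] at this
  omega

theorem Sizes.input_le (h : Sizes n c N) (a : ℕ) : (inputState G ω).mem a ≤ c * N := by
  have h1 := h.one_le
  have h2 : c ≤ c * N := Nat.le_mul_of_pos_right _ (h.pos_n.trans h.le_N)
  simp only [inputState]
  split_ifs with ha
  · exact (ω ⟨a, ha⟩).2.le.trans h2
  · exact h1
  · exact Nat.zero_le _

theorem update_two_vars {i v m' : ℕ} :
    Function.update (Function.update (Function.update (vars n c m) 3 i) 4 v) 2 m' =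
      Function.update (Function.update (vars n c m') 3 i) 4 v := by
  funext r
  simp only [Function.update_apply, vars]
  split_ifs <;> first | rfl | omega

theorem tri_init (h : Sizes n c N)
    (hQ : ∀ mem S, (∀ a, mem a ≤ c * N) → Input G ω mem → Bits c n S mem → Search G 0 0 n S →
      Q (vars n c n) mem) :
    Tri W (c * N) (vars n c N) initStmt (vars n c 0) (inputState G ω).mem Q := by
  classical
  have hok := h.ok (m := 0) (Nat.zero_le _) (h.input_le (G := G) (ω := ω))
  refine Tri.seq (Tri.forMem (by omega) hok (fun k mem => (∀ a, mem a ≤ c * N) ∧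
    Input G ω mem ∧ ∀ j < n, ∀ u < n, mem (base n c + j * n + u) = if j = u ∧ j < k then 1 else 0)
    ⟨h.input_le, fun _ _ => rfl, ?_⟩ ?_ ?_)
  · intro j _ u _
    rw [input_eq_zero (by omega)]
    simp
  · rintro k hk mem ⟨hle, hin, hb⟩
    have hk : k < n := hk
    refine Tri.put ((h.ok (Nat.zero_le _) hle).update le_rfl (hk.le.trans h.n_le)) ?_
    have ha : (bitAddr (.var 3) (.var 3)).eval (Function.update (vars n c 0) 3 k) mem =
        base n c + k * n + k := by
      simp [bitAddr, bitBase, Ex.eval, vars, base]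
    rw [ha]
    refine ⟨rfl, update_le hle h.one_le, ?_, ?_⟩
    · intro a hab
      rw [Function.update_of_ne (by omega)]
      exact hin a hab
    · intro j hj u hu
      rw [Function.update_apply, hb j hj u hu]
      have := row_eq_iff hu hk (i := j) (j := k)
      by_cases hjk : j = k ∧ u = k
      · obtain ⟨rfl, rfl⟩ := hjk
        simp [Ex.eval]
      · rw [if_neg (by omega)]
        refine if_congr ?_ rfl rfl
        omega
  · rintro mem ⟨hle, hin, hb⟩
    refine Tri.set (h.ok (Nat.zero_le _) hle) ?_
    have hv : Function.update (vars n c 0) 2 (Ex.eval (.var 0) (vars n c 0) mem) = vars n c n := by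
      funext r
      simp only [Function.update_apply, vars, Ex.eval]
      split_ifs <;> first | rfl | omega
    rw [hv]
    refine hQ mem (fun j => Finset.univ.filter fun u => (u : ℕ) = j) hle hin ?_ (Search.init _ ?_)
    · intro j hj u
      rw [hb j hj u u.2]
      refine if_congr ?_ rfl rfl
      simp [vars]
      omega
    · intro v
      ext u
      simp [Fin.ext_iff]

/-- Row `m` lies behind all stored sets, so the candidate is written without disturbing them,
whether or not it is accepted later. -/
theorem tri_copy (h : Sizes n c N) {i v : ℕ} (hm : m ≤ N) (hle : ∀ a, mem a ≤ c * N)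
    (hb : Bits c m S mem) (hi : i < m) (hv : v < n)
    (hQ : ∀ mem', (∀ a, mem' a ≤ c * N) → (∀ a < base n c + m * n, mem' a = mem a) →
      Bits c (m + 1) (Function.update S m (insert ⟨v, hv⟩ (S i))) mem' →
      Q (Function.update (Function.update (vars n c m) 3 i) 4 v) mem') :
    Tri W (c * N) (vars n c N) copyStmt (Function.update (Function.update (vars n c m) 3 i) 4 v) mem Q := by
  classical
  have h3 : N ≤ c * N := Nat.le_mul_of_pos_left _ h.pos_c
  have hok : ∀ mem', (∀ a, mem' a ≤ c * N) → Ok (c * N) (vars n c N)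
      (Function.update (Function.update (vars n c m) 3 i) 4 v) mem' := fun mem' hle' =>
    ((h.ok hm hle').update le_rfl (by omega)).update (by omega) (hv.le.trans h.n_le)
  have hlim : Function.update (Function.update (vars n c m) 3 i) 4 v 0 = n := by simp [vars]
  refine Tri.forMem (by omega) (hok mem hle) (fun k mem' => (∀ a, mem' a ≤ c * N) ∧
    (∀ a < base n c + m * n, mem' a = mem a) ∧ ∀ u : Fin n, (u : ℕ) < k →
      mem' (base n c + m * n + u) = if u ∈ insert ⟨v, hv⟩ (S i) then 1 else 0)
    ⟨hle, fun _ _ => rfl, by omega⟩ ?_ ?_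
  · rintro k hk mem' ⟨hle', heq, hu⟩
    rw [hlim] at hk
    refine Tri.put ((hok mem' hle').update (by omega) (hk.le.trans h.n_le)) ?_
    have hbit : mem' (base n c + i * n + k) = if (⟨k, hk⟩ : Fin n) ∈ S i then 1 else 0 := by
      rw [heq _ (by have := row_lt hi hk; omega)]
      exact hb i hi ⟨k, hk⟩
    have ha : (bitAddr (.var 2) (.var 5)).eval (Function.update (Function.update (Function.update
        (vars n c m) 3 i) 4 v) 5 k) mem' = base n c + m * n + k := by
      simp [bitAddr, bitBase, Ex.eval, vars, base]
    have hval : (isZero (.mul (isZero (bit (.var 3) (.var 5))) (dist (.var 5) (.var 4)))).eval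
        (Function.update (Function.update (Function.update (vars n c m) 3 i) 4 v) 5 k) mem' =
        if (⟨k, hk⟩ : Fin n) ∈ insert ⟨v, hv⟩ (S i) then 1 else 0 := by
      have : (bit (.var 3) (.var 5)).eval (Function.update (Function.update (Function.update
          (vars n c m) 3 i) 4 v) 5 k) mem' = mem' (base n c + i * n + k) := by
        simp [bit, bitAddr, bitBase, Ex.eval, vars, base]
      simp only [isZero, dist, Ex.eval, this, hbit]
      simp only [Function.update_apply, Finset.mem_insert, Fin.mk.injEq]
      by_cases hkS : (⟨k, hk⟩ : Fin n) ∈ S i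
      · simp [hkS]
      · by_cases hkv : k = v
        · simp [hkv]
        · simp [hkS, hkv]
          omega
    rw [ha, hval]
    refine ⟨rfl, update_le hle' (by split_ifs <;> have := h.one_le <;> omega), ?_, ?_⟩
    · intro a hab
      rw [Function.update_of_ne (by omega)]
      exact heq a hab
    · intro u huk
      rcases Nat.lt_succ_iff_lt_or_eq.1 huk with huk | huk
      · rw [Function.update_of_ne (by omega)]
        exact hu u huk
      · obtain rfl : u = ⟨k, hk⟩ := Fin.ext huk
        simp
  · rintro mem' ⟨hle', heq, hu⟩
    rw [hlim] at hu
    refine hQ mem' hle' heq ?_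
    intro j hj u
    rcases Nat.lt_succ_iff_lt_or_eq.1 hj with hj | rfl
    · rw [Function.update_of_ne (by omega), heq _ (by have := row_lt hj u.2; omega)]
      exact hb j hj u
    · rw [Function.update_self]
      exact hu u u.2

theorem sum_bits (f : Fin n → Prop) [DecidablePred f] :
    1 - (1 - ∑ u : Fin n, if f u then 1 else 0) = if ∃ u, f u then 1 else 0 := by
  by_cases hf : ∃ u, f u
  · obtain ⟨u, hu⟩ := hf
    have : 1 ≤ ∑ u : Fin n, if f u then 1 else 0 := by
      refine le_trans ?_ (Finset.single_le_sum (fun _ _ => Nat.zero_le _) (Finset.mem_univ u))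
      simp [hu]
    rw [if_pos ⟨u, hu⟩]
    omega
  · rw [if_neg hf]
    have hf' : ∀ u, ¬ f u := fun u hu => hf ⟨u, hu⟩
    simp [hf']

theorem sum_dist (A B : Finset (Fin n)) [DecidableEq (Fin n)] :
    1 - ∑ u : Fin n, (((if u ∈ A then 1 else 0) - (if u ∈ B then 1 else 0)) +
      ((if u ∈ B then 1 else 0) - (if u ∈ A then 1 else 0))) = if A = B then 1 else 0 := by
  by_cases hAB : A = B
  · subst hAB; simp
  · rw [if_neg hAB, Nat.sub_eq_zero_iff_le]
    obtain ⟨u, hu⟩ : ∃ u, ¬ (u ∈ A ↔ u ∈ B) := by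
      by_contra hcon
      push Not at hcon
      exact hAB (Finset.ext hcon)
    refine le_trans ?_ (Finset.single_le_sum (fun _ _ => Nat.zero_le _) (Finset.mem_univ u))
    by_cases hA : u ∈ A <;> by_cases hB : u ∈ B <;> simp_all

theorem sum_found {m : ℕ} (f : ℕ → Prop) [DecidablePred f] :
    (1 - ∑ j ∈ Finset.range m, if f j then 1 else 0) = if ∃ j < m, f j then 0 else 1 := by
  by_cases hf : ∃ j < m, f j
  · obtain ⟨j, hj, hfj⟩ := hf
    rw [if_pos ⟨j, hj, hfj⟩, Nat.sub_eq_zero_iff_le]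
    refine le_trans ?_ (Finset.single_le_sum (fun _ _ => Nat.zero_le _) (Finset.mem_range.2 hj))
    simp [hfj]
  · rw [if_neg hf, Finset.sum_eq_zero fun j hj =>
      if_neg fun hfj => hf ⟨j, Finset.mem_range.1 hj, hfj⟩, Nat.sub_zero]

open Classical in
theorem eval_countEx {i v : ℕ} (hin : Input G ω mem) {A : Finset (Fin n)} (hi : i < m) (hv : v < n)
    (hb : Bits c (m + 1) (Function.update S m A) mem) :
    countEx.eval (Function.update (Function.update (vars n c m) 3 i) 4 v) mem =
      m + (if ∃ u, u ∈ S i ∧ G.Adj u ⟨v, hv⟩ then 1 else 0) * (if ∃ j < m, S j = A then 0 else 1) := by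
  have hS : ∀ j < m, Function.update S m A j = S j := fun j hj => Function.update_of_ne (by omega) _ _
  have hbit : ∀ j < m, ∀ u : Fin n, mem (base n c + j * n + u) = if u ∈ S j then 1 else 0 := by
    intro j hj u
    rw [hb j (by omega) u, hS j hj]
  have hbm : ∀ u : Fin n, mem (base n c + m * n + u) = if u ∈ A then 1 else 0 := by
    intro u
    rw [hb m (by omega) u, Function.update_self]
  have hadj : ∀ u : Fin n, mem (n + n * u + v) = if G.Adj u ⟨v, hv⟩ then 1 else 0 := by
    intro u
    rw [hin _ (by have := row_lt u.2 hv; rw [mul_comm] at this; unfold base; omega)]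
    exact input_adj u ⟨v, hv⟩
  have hbe : ∀ (a : Ex) (env : ℕ → ℕ), env 0 = n → env 1 = c →
      (bit a (.var 5)).eval env mem = mem (base n c + a.eval env mem * n + env 5) := by
    intro a env h0 h1
    simp [bit, bitAddr, bitBase, Ex.eval, base, h0, h1]
  simp only [countEx, isZero, dist, Ex.eval, foldUpTo_false]
  simp only [zero_add]
  have hlim : vars n c m 0 = n ∧ vars n c m 2 = m := by simp [vars]
  simp only [Function.update_of_ne (show (0 : ℕ) ≠ 6 by decide),
    Function.update_of_ne (show (0 : ℕ) ≠ 4 by decide), Function.update_of_ne (show (0 : ℕ) ≠ 3 by decide),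
    Function.update_of_ne (show (2 : ℕ) ≠ 4 by decide), Function.update_of_ne (show (2 : ℕ) ≠ 3 by decide),
    hlim]
  simp only [Finset.sum_range (n := n)]
  congr 2
  · rw [← sum_bits]
    congr 2
    refine Finset.sum_congr rfl fun u _ => ?_
    rw [hbe _ _ (by simp [vars]) (by simp [vars])]
    simp only [Ex.eval, Function.update_apply, vars, OfNat.ofNat_ne_zero, OfNat.zero_ne_ofNat,
      Nat.reduceEqDiff, if_true, if_false, hbit i hi u, hadj u]
    by_cases h1 : u ∈ S i <;> by_cases h2 : G.Adj u ⟨v, hv⟩ <;> simp [h1, h2]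
  · rw [← sum_found]
    congr 1
    refine Finset.sum_congr rfl fun j hj => ?_
    rw [← sum_dist]
    congr 1
    refine Finset.sum_congr rfl fun u _ => ?_
    rw [hbe _ _ (by simp [vars]) (by simp [vars]), hbe _ _ (by simp [vars]) (by simp [vars])]
    simp only [Ex.eval, Function.update_apply, vars, OfNat.ofNat_ne_zero, OfNat.ofNat_ne_one,
      Nat.reduceEqDiff, if_true, if_false, hbit j (Finset.mem_range.1 hj) u, hbm u]

/-- At every stage the list consists of distinct connected sets, so its length is at most `N`. This
bounds time and word size although the program does not know `N`. -/
theorem tri_search (h : Sizes n c N) (hG : numConnected G ≤ N) (hle : ∀ a, mem a ≤ c * N)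
    (hin : Input G ω mem) (hb : Bits c m S mem) (hS : Search G 0 0 m S)
    (hQ : ∀ m mem S, (∀ a, mem a ≤ c * N) → Input G ω mem → Bits c m S mem → Enum G m S →
      Q (vars n c m) mem) :
    Tri W (c * N) (vars n c N) searchStmt (vars n c m) mem Q := by
  classical
  have h3 : N ≤ c * N := Nat.le_mul_of_pos_left _ h.pos_c
  have hvv : ∀ m i, Function.update (Function.update (vars n c m) 3 i) 3 0 = vars n c m := by
    intro m i
    funext r
    simp only [Function.update_apply, vars]
    split_ifs <;> first | rfl | omega
  refine Tri.forTo (fun i env mem => ∃ m S, env = vars n c m ∧ (∀ a, mem a ≤ c * N) ∧ Input G ω mem ∧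
    Bits c m S mem ∧ Search G i 0 m S) (Nat.zero_le _) ⟨m, S, rfl, hle, hin, hb, hS⟩ ?_ ?_
  · rintro i _ mem ⟨m, S, rfl, hle, hin, hb, hS⟩ - hi
    have hi : i < m := hi
    have hmN := hS.le_numConnected.trans hG
    refine ⟨⟨hmN, hmN.trans h3⟩, ?_⟩
    refine Tri.forTo (fun v env mem => ∃ m S, env = Function.update (vars n c m) 3 i ∧
      (∀ a, mem a ≤ c * N) ∧ Input G ω mem ∧ Bits c m S mem ∧ Search G i v m S ∧ i < m ∧ v ≤ n)
      (by simp [vars]) ⟨m, S, rfl, hle, hin, hb, hS, hi, Nat.zero_le _⟩ ?_ ?_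
    · clear hS hb hin hle hi hmN
      rintro v _ mem ⟨m, S, rfl, hle, hin, hb, hS, hi, -⟩ - hv
      have hv : v < n := hv
      have hmN := hS.le_numConnected.trans hG
      refine ⟨⟨le_rfl, h.n_le⟩, Tri.seq (tri_copy h hmN hle hb hi hv ?_)⟩
      intro mem' hle' heq hb'
      have hin' : Input G ω mem' := fun a ha => (heq a (by omega)).trans (hin a ha)
      refine Tri.set (((h.ok hmN hle').update le_rfl (by omega)).update (by omega)
        (hv.le.trans h.n_le)) ?_
      rw [eval_countEx hin' hi hv hb', update_two_vars]
      refine ⟨by simp, ?_⟩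
      have hrest : ∀ m₁ m', Function.update (Function.update (Function.update (vars n c m') 3 i) 4 v) 4
          (Function.update (vars n c m₁) 3 i 4) = Function.update (vars n c m') 3 i := by
        intro m₁ m'
        funext r
        by_cases hr : r = 4 <;> simp [hr, vars]
      rw [hrest]
      by_cases hadj : ∃ u, u ∈ S i ∧ G.Adj u ⟨v, hv⟩
      · by_cases hf : ∃ j < m, S j = insert ⟨v, hv⟩ (S i)
        · refine ⟨m, S, by simp [hf], hle', hin', ?_, hS.skip hv fun _ => hf, hi, hv⟩
          intro j hj u
          have := hb' j (by omega) u
          rwa [Function.update_of_ne (by omega)] at this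
        · refine ⟨m + 1, _, by rw [if_pos hadj, if_neg hf], hle', hin', hb',
            hS.append hi hv hadj ?_, by omega, hv⟩
          intro j hj hjA
          exact hf ⟨j, hj, hjA⟩
      · refine ⟨m, S, by rw [if_neg hadj, zero_mul, add_zero], hle', hin', ?_,
          hS.skip hv fun h => absurd h hadj, hi, hv⟩
        intro j hj u
        have := hb' j (by omega) u
        rwa [Function.update_of_ne (by omega)] at this
    · rintro v _ mem' ⟨m', S', rfl, hle', hin', hb', hS', hi', hv'⟩ hv
      have hv : n ≤ v := hv
      obtain rfl : v = n := le_antisymm hv' hv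
      refine ⟨by simp, m', S', ?_, hle', hin', hb', hS'.next⟩
      exact hvv m' i
  · rintro i _ mem' ⟨m', S', rfl, hle', hin', hb', hS'⟩ hi
    exact hQ m' mem' S' hle' hin' hb' (hS'.finish hi)

end Correctness

end FloodIt

namespace FloodIt

/-! ### Filling the tables of intersections and costs, and the output -/

section Correctness

variable {n c N : ℕ} {G : SimpleGraph (Fin n)} {ω : Fin n → Fin c} {m : ℕ} {S : ℕ → Finset (Fin n)}
  {mem : ℕ → ℕ} {W : ℕ} {Q : (ℕ → ℕ) → (ℕ → ℕ) → Prop}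

/-- The start of the table of intersection sizes. -/
def base₂ (n c m : ℕ) : ℕ := base n c + (m + 1) * n

/-- The start of the table of costs. -/
def base₃ (n c m : ℕ) : ℕ := base₂ n c m + m * m

def interSize (n c m : ℕ) (mem : ℕ → ℕ) (i j : ℕ) : ℕ := mem (base₂ n c m + (i * m + j))

/-- The table of costs in memory. -/
def table (n c m : ℕ) (mem : ℕ → ℕ) (j d : ℕ) : ℕ := mem (base₃ n c m + (j * c + d))

/-- The memory holds the sizes of the intersections. -/
def Inters (c m : ℕ) (S : ℕ → Finset (Fin n)) (mem : ℕ → ℕ) : Prop :=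
  ∀ i < m, ∀ j < m, interSize n c m mem i j = (S i ∩ S j).card

theorem bits_lt {j : ℕ} (hj : j < m) (u : Fin n) : base n c + j * n + u < base₂ n c m := by
  have := row_lt (show j < m + 1 by omega) u.2
  unfold base₂
  omega

theorem inters_lt {i j : ℕ} (hi : i < m) (hj : j < m) :
    base₂ n c m + (i * m + j) < base₃ n c m := by
  have := row_lt hi hj
  unfold base₃
  omega

theorem Bits.congr {mem' : ℕ → ℕ} (hb : Bits c m S mem) {b : ℕ} (hbase : base₂ n c m ≤ b)
    (h : ∀ a < b, mem' a = mem a) : Bits c m S mem' := fun j hj u =>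
  (h _ ((bits_lt hj u).trans_le hbase)).trans (hb j hj u)

theorem Inters.congr {mem' : ℕ → ℕ} (hI : Inters c m S mem)
    (h : ∀ a < base₃ n c m, mem' a = mem a) : Inters c m S mem' := fun i hi j hj =>
  (h _ (inters_lt hi hj)).trans (hI i hi j hj)

theorem Input.congr {mem' : ℕ → ℕ} (hin : Input G ω mem) {b : ℕ} (hbase : base n c ≤ b)
    (h : ∀ a < b, mem' a = mem a) : Input G ω mem' := fun a ha =>
  (h _ (ha.trans_le hbase)).trans (hin a ha)

theorem eval_bit {i u : Ex} {env : ℕ → ℕ} (h0 : env 0 = n) (h1 : env 1 = c) :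
    (bit i u).eval env mem = mem (base n c + i.eval env mem * n + u.eval env mem) := by
  simp [bit, bitAddr, bitBase, Ex.eval, base, h0, h1]

theorem eval_interAddr {i j : Ex} {env : ℕ → ℕ} (h0 : env 0 = n) (h1 : env 1 = c) (h2 : env 2 = m) :
    (interAddr i j).eval env mem = base₂ n c m + (i.eval env mem * m + j.eval env mem) := by
  simp [interAddr, interBase, bitBase, Ex.eval, base₂, base, h0, h1, h2, add_assoc]

theorem eval_inter {i j : Ex} {env : ℕ → ℕ} (h0 : env 0 = n) (h1 : env 1 = c) (h2 : env 2 = m) :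
    (inter i j).eval env mem = interSize n c m mem (i.eval env mem) (j.eval env mem) := by
  rw [inter, Ex.eval, eval_interAddr h0 h1 h2]
  rfl

theorem eval_tableAddr {i j : Ex} {env : ℕ → ℕ} (h0 : env 0 = n) (h1 : env 1 = c) (h2 : env 2 = m) :
    (tableAddr i j).eval env mem = base₃ n c m + (i.eval env mem * c + j.eval env mem) := by
  simp [tableAddr, tableBase, interBase, bitBase, Ex.eval, base₃, base₂, base, h0, h1, h2, add_assoc]

theorem eval_costEx {j d : Ex} {a b : ℕ} {env : ℕ → ℕ} (h0 : env 0 = n) (h1 : env 1 = c)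
    (h2 : env 2 = m) (hj : j.eval env mem = a) (hj' : ∀ k, j.eval (Function.update env 7 k) mem = a)
    (hd : d.eval env mem = b) : (costEx j d).eval env mem = cost (table n c m mem) c a b := by
  simp only [costEx, Ex.eval, cost, h1]
  refine foldUpTo_congr _ ?_ fun k _ => ?_
  · rw [eval_tableAddr h0 h1 h2, hj, hd]
    rfl
  · rw [eval_tableAddr (n := n) (c := c) (m := m) (by simpa) (by simpa) (by simpa), hj']
    simp [Ex.eval, table]

theorem card_eq_sum_ite (A : Finset (Fin n)) : A.card = ∑ u : Fin n, if u ∈ A then 1 else 0 := by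
  simp

theorem tri_inter (h : Sizes n c N) (hm : m ≤ N) (hle : ∀ a, mem a ≤ c * N)
    (hin : Input G ω mem) (hb : Bits c m S mem)
    (hQ : ∀ mem, (∀ a, mem a ≤ c * N) → Input G ω mem → Bits c m S mem → Inters c m S mem →
      Q (vars n c m) mem) :
    Tri W (c * N) (vars n c N) interStmt (vars n c m) mem Q := by
  have hbb : base n c ≤ base₂ n c m := Nat.le_add_right _ _
  refine Tri.fill (b := base₂ n c m) (by omega) (by omega) (h.ok hm hle)
    (fun i j mem => interSize n c m mem i j = (S i ∩ S j).card) ?_ ?_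
  · intro i hi j hj mem' hle' heq hD
    have hi : i < m := hi
    have hj : j < m := hj
    change ∀ i' j', i' < m → j' < m → _ at hD
    have hm2 : vars n c m 2 = m := rfl
    have hval : interEx.eval (Function.update (Function.update (vars n c m) 3 i) 4 j) mem' =
        (S i ∩ S j).card := by
      have hlim : Function.update (Function.update (vars n c m) 3 i) 4 j 0 = n := by simp [vars]
      have hb' := hb.congr le_rfl heq
      simp only [interEx, Ex.eval, foldUpTo_false, zero_add, hlim]
      rw [Finset.sum_range, card_eq_sum_ite]
      refine Finset.sum_congr rfl fun u _ => ?_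
      rw [eval_bit (n := n) (c := c) (by simp [vars]) (by simp [vars]),
        eval_bit (n := n) (c := c) (by simp [vars]) (by simp [vars])]
      have h1 := hb' i hi u
      have h2 := hb' j hj u
      simp only [Ex.eval, Function.update_apply, Nat.reduceEqDiff, if_true, if_false,
        h1, h2, Finset.mem_inter]
      by_cases hui : u ∈ S i <;> by_cases huj : u ∈ S j <;> simp [hui, huj]
    refine ⟨?_, ?_, ?_⟩
    · rw [eval_interAddr (n := n) (c := c) (m := m) (by simp [vars]) (by simp [vars]) (by simp [vars])]
      simp [Ex.eval, vars]
    · rw [hval]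
      exact (Finset.card_le_univ _).trans (by simpa using h.n_le)
    · intro i' j' hi' hj' hlt
      rw [hval, hm2]
      simp only [interSize, Function.update_apply]
      by_cases hij : i' = i ∧ j' = j
      · rw [hij.1, hij.2, if_pos rfl]
      · have := row_eq_iff hj' hj (i := i') (j := i)
        rw [hm2] at this hj'
        rw [if_neg (by omega)]
        exact hD i' j' hi' hj' (by omega)
  · intro mem' hle' heq hD
    exact hQ mem' hle' (hin.congr hbb heq) (hb.congr le_rfl heq) hD

theorem eval_wrongEx (hin : Input G ω mem) (hb : Bits c m S mem) {j d : ℕ} (hj : j < m) :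
    wrongEx.eval (Function.update (Function.update (vars n c m) 3 j) 4 d) mem = wrong ω (S j) d := by
  classical
  have hlim : Function.update (Function.update (vars n c m) 3 j) 4 d 0 = n := by simp [vars]
  simp only [wrongEx, Ex.eval, foldUpTo_false, zero_add, hlim]
  rw [Finset.sum_range, wrong, card_eq_sum_ite]
  refine Finset.sum_congr rfl fun u _ => ?_
  rw [eval_bit (n := n) (c := c) (by simp [vars]) (by simp [vars])]
  have h1 := hb j hj u
  have h2 : mem u = ω u := (hin _ (by unfold base; omega)).trans (input_color u)
  simp only [isZero, dist, Ex.eval, Function.update_apply, Nat.reduceEqDiff, if_true,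
    if_false, h1, h2, Finset.mem_filter]
  by_cases huj : u ∈ S j
  · by_cases hd : (ω u : ℕ) = d
    · simp [huj, hd]
    · simp [huj, hd]
      omega
  · simp [huj]

/-- Both parts are nonempty, hence strictly smaller than the union, and the list is sorted by size.
The order of the list is thus a valid order for filling the table. -/
theorem lt_of_union_eq (hS : Enum G m S) {a b j : ℕ} (ha : a < m) (hb : b < m)
    (hab : Disjoint (S a) (S b)) (h : S a ∪ S b = S j) : a < j ∧ b < j := by
  have hcard : (S a).card + (S b).card = (S j).card := by
    rw [← Finset.card_union_of_disjoint hab, h]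
  have hpa : 0 < (S a).card := by
    obtain ⟨⟨x, hx⟩⟩ := (hS.conn a ha).nonempty
    exact Finset.card_pos.2 ⟨x, hx⟩
  have hpb : 0 < (S b).card := by
    obtain ⟨⟨x, hx⟩⟩ := (hS.conn b hb).nonempty
    exact Finset.card_pos.2 ⟨x, hx⟩
  constructor
  · by_contra hle
    have := hS.sorted a ha j (by omega)
    omega
  · by_contra hle
    have := hS.sorted b hb j (by omega)
    omega

/-- The recursion for row `j` depends only on earlier rows. Rows not yet filled may therefore
contain anything, and later writes do not spoil finished entries. -/
theorem recursion_iff_of_agree (hS : Enum G m S) {T T' : ℕ → ℕ → ℕ} {j d : ℕ}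
    (hT : ∀ a < j, ∀ e < c, T a e = T' a e) {z : ℕ} (hd : d < c) :
    (wrong ω (S j) d ≤ z ∨ ∃ a < m, ∃ b < m, Disjoint (S a) (S b) ∧ S a ∪ S b = S j ∧
      cost T c a d + cost T c b d ≤ z) ↔
    (wrong ω (S j) d ≤ z ∨ ∃ a < m, ∃ b < m, Disjoint (S a) (S b) ∧ S a ∪ S b = S j ∧
      cost T' c a d + cost T' c b d ≤ z) := by
  have hc : ∀ a < j, cost T c a d = cost T' c a d := fun a ha =>
    foldUpTo_congr _ (hT a ha d hd) fun e he => by rw [hT a ha e he]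
  refine or_congr_right (exists_congr fun a => and_congr_right fun ha => exists_congr fun b =>
    and_congr_right fun hb => and_congr_right fun hab => and_congr_right fun h => ?_)
  obtain ⟨haj, hbj⟩ := lt_of_union_eq hS ha hb hab h
  rw [hc a haj, hc b hbj]

theorem eval_tableEx_le (hin : Input G ω mem) (hb : Bits c m S mem) (hI : Inters c m S mem) {j d z : ℕ}
    (hj : j < m) :
    tableEx.eval (Function.update (Function.update (vars n c m) 3 j) 4 d) mem ≤ z ↔
      wrong ω (S j) d ≤ z ∨ ∃ a < m, ∃ b < m, Disjoint (S a) (S b) ∧ S a ∪ S b = S j ∧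
        cost (table n c m mem) c a d + cost (table n c m mem) c b d ≤ z := by
  have hw : wrong ω (S j) d ≤ n := (Finset.card_le_univ _).trans (by simp)
  have hlim : Function.update (Function.update (vars n c m) 3 j) 4 d 2 = m := by simp [vars]
  have hlim' : ∀ a, Function.update (Function.update (Function.update (vars n c m) 3 j) 4 d) 5 a 2 = m := by
    simp [vars]
  rw [tableEx, Ex.eval, foldUpTo_true_le, eval_wrongEx hin hb hj, hlim]
  simp only [Ex.eval, foldUpTo_true_le, hlim']
  have hdef : ∀ a < m, ∀ b < m, defect.eval (Function.update (Function.update (Function.update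
      (Function.update (vars n c m) 3 j) 4 d) 5 a) 6 b) mem = 0 ↔
      Disjoint (S a) (S b) ∧ S a ∪ S b = S j := by
    intro a ha b hb
    rw [← defect_eq_zero_iff, ← hI a ha a ha, ← hI b hb b hb, ← hI a ha b hb, ← hI a ha j hj,
      ← hI b hb j hj, ← hI j hj j hj]
    simp only [defect, Ex.eval]
    simp only [eval_inter (n := n) (c := c) (m := m) (env := Function.update (Function.update
      (Function.update (Function.update (vars n c m) 3 j) 4 d) 5 a) 6 b) (by simp [vars])
      (by simp [vars]) (by simp [vars])]
    simp [Ex.eval]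
  constructor
  · rintro (h | ⟨a, ha, h | ⟨b, hb', h⟩⟩)
    · exact Or.inl h
    · left
      simp [vars] at h
      omega
    -- Otherwise `z < wrong ω (S j) d ≤ n`, so the penalty `n + 1` cannot be present and the defect
    -- must vanish.
    · by_cases hz : wrong ω (S j) d ≤ z
      · exact Or.inl hz
      · right
        rw [eval_costEx (n := n) (c := c) (m := m) (a := a) (b := d) (by simp [vars]) (by simp [vars])
          (by simp [vars]) (by simp [Ex.eval]) (by simp [Ex.eval]) (by simp [Ex.eval]),
          eval_costEx (n := n) (c := c) (m := m) (a := b) (b := d) (by simp [vars]) (by simp [vars])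
          (by simp [vars]) (by simp [Ex.eval]) (by simp [Ex.eval]) (by simp [Ex.eval])] at h
        have h0 : defect.eval (Function.update (Function.update (Function.update
            (Function.update (vars n c m) 3 j) 4 d) 5 a) 6 b) mem = 0 := by
          by_contra hne
          have h1 := Nat.mul_le_mul_left (n + 1) (Nat.one_le_iff_ne_zero.2 hne)
          have h2 : Function.update (Function.update (Function.update
            (Function.update (vars n c m) 3 j) 4 d) 5 a) 6 b 0 = n := by simp [vars]
          rw [h2] at h
          omega
        rw [h0, mul_zero, add_zero] at h
        obtain ⟨h1, h2⟩ := (hdef a ha b hb').1 h0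
        exact ⟨a, ha, b, hb', h1, h2, h⟩
  · rintro (h | ⟨a, ha, b, hb', h1, h2, h⟩)
    · exact Or.inl h
    · refine Or.inr ⟨a, ha, Or.inr ⟨b, hb', ?_⟩⟩
      rw [eval_costEx (n := n) (c := c) (m := m) (a := a) (b := d) (by simp [vars]) (by simp [vars])
        (by simp [vars]) (by simp [Ex.eval]) (by simp [Ex.eval]) (by simp [Ex.eval]),
        eval_costEx (n := n) (c := c) (m := m) (a := b) (b := d) (by simp [vars]) (by simp [vars])
        (by simp [vars]) (by simp [Ex.eval]) (by simp [Ex.eval]) (by simp [Ex.eval]),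
        (hdef a ha b hb').2 ⟨h1, h2⟩, mul_zero, add_zero]
      exact h

theorem tri_table (h : Sizes n c N) (hm : m ≤ N) (hS : Enum G m S) (hle : ∀ a, mem a ≤ c * N)
    (hin : Input G ω mem) (hb : Bits c m S mem) (hI : Inters c m S mem)
    (hQ : ∀ mem, (∀ a, mem a ≤ c * N) → (∀ j < m, ∀ d < c, Recursion ω m S (table n c m mem) j d) →
      Q (vars n c m) mem) :
    Tri W (c * N) (vars n c N) tableStmt (vars n c m) mem Q := by
  have hb2 : base₂ n c m ≤ base₃ n c m := Nat.le_add_right _ _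
  have hb1 : base n c ≤ base₃ n c m := (Nat.le_add_right _ _).trans hb2
  refine Tri.fill (b := base₃ n c m) (by omega) (by omega) (h.ok hm hle)
    (fun j d mem => Recursion ω m S (table n c m mem) j d) ?_ ?_
  · intro i hi j hj mem' hle' heq hD
    have hi : i < m := hi
    have hj : j < c := hj
    change ∀ i' j', i' < m → j' < c → _ at hD
    have hc1 : vars n c m 1 = c := rfl
    have hval := fun z => eval_tableEx_le (hin.congr hb1 heq) (hb.congr hb2 heq) (hI.congr heq) hi
      (d := j) (z := z)
    set val := tableEx.eval (Function.update (Function.update (vars n c m) 3 i) 4 j) mem' with hvaldef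
    refine ⟨?_, ?_, ?_⟩
    · rw [eval_tableAddr (n := n) (c := c) (m := m) (by simp [vars]) (by simp [vars]) (by simp [vars])]
      simp [Ex.eval, vars]
    · exact (hval _).2 (Or.inl ((Finset.card_le_univ _).trans (by simpa using h.n_le)))
    · intro i' j' hi' hj' hlt
      have hj' : j' < c := hj'
      rw [hc1]
      set mem'' := Function.update mem' (base₃ n c m + (i * c + j)) val with hmem''
      have hne : ∀ a e, e < c → ¬ (a = i ∧ e = j) → table n c m mem'' a e = table n c m mem' a e := by
        intro a e he hae
        have := row_eq_iff he hj (i := a) (j := i)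
        exact Function.update_of_ne (by omega) _ _
      have hrow : ∀ a < i', ∀ e < c, table n c m mem'' a e = table n c m mem' a e := fun a ha e he =>
        hne a e he (by omega)
      intro z
      -- Row `i'` is at most the row being written, so all rows below it are unchanged by the write.
      rw [recursion_iff_of_agree hS hrow hj']
      by_cases hij : i' = i ∧ j' = j
      · obtain ⟨rfl, rfl⟩ := hij
        have : table n c m mem'' i' j' = val := Function.update_self _ _ _
        rw [this]
        exact hval z
      · rw [hne i' j' hj' hij]
        exact hD i' j' hi' hj' (by omega) z
  · intro mem' hle' heq hD
    exact hQ mem' hle' hD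

/-- The output cells `0, …, c` may overwrite the input, which is no longer needed. They lie below
`base n c`, so the table of costs remains readable meanwhile. -/
theorem tri_out (h : Sizes n c N) (hm : m ≤ N) (hm0 : 0 < m) (hle : ∀ a, mem a ≤ c * N)
    (hT : ∀ j < m, ∀ d < c, Recursion ω m S (table n c m mem) j d)
    (hQ : ∀ mem', (∀ d < c, mem' d = cost (table n c m mem) c (m - 1) d) →
      mem' c = foldUpTo true n (cost (table n c m mem) c (m - 1)) c → Q (vars n c m) mem') :
    Tri W (c * N) (vars n c N) outStmt (vars n c m) mem Q := by
  have hcle : ∀ d < c, cost (table n c m mem) c (m - 1) d ≤ n := fun d hd =>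
    cost_le.2 (Or.inl (table_le hT (by omega) hd))
  have hcX : c ≤ c * N := Nat.le_mul_of_pos_right _ (h.pos_n.trans h.le_N)
  have hcb : c < base n c := by unfold base; omega
  have hb : base n c ≤ base₃ n c m := (Nat.le_add_right _ _).trans (Nat.le_add_right _ _)
  have htab : ∀ mem', (∀ a, base n c ≤ a → mem' a = mem a) → table n c m mem' = table n c m mem := by
    intro mem' h
    funext j d
    exact h _ (hb.trans (Nat.le_add_right _ _))
  have hout : ∀ mem' k, (∀ a, base n c ≤ a → mem' a = mem a) →
      outEx.eval (Function.update (vars n c m) 3 k) mem' = cost (table n c m mem) c (m - 1) k := by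
    intro mem' k hmem'
    rw [← htab mem' hmem']
    exact eval_costEx (by simp [vars]) (by simp [vars]) (by simp [vars]) (by simp [Ex.eval, vars])
      (by simp [Ex.eval, vars]) (by simp [Ex.eval])
  refine Tri.seq (Tri.forMem (by omega) (h.ok hm hle) (fun k mem' => (∀ a, mem' a ≤ c * N) ∧
    (∀ a, base n c ≤ a → mem' a = mem a) ∧ ∀ d < k, mem' d = cost (table n c m mem) c (m - 1) d)
    ⟨hle, fun _ _ => rfl, by omega⟩ ?_ ?_)
  · rintro k hk mem' ⟨hle', heq, hd⟩
    have hk : k < c := hk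
    refine Tri.put ((h.ok hm hle').update le_rfl (hk.le.trans hcX)) ?_
    rw [hout mem' k heq]
    have ha : (Ex.var 3).eval (Function.update (vars n c m) 3 k) mem' = k := by simp [Ex.eval]
    rw [ha]
    refine ⟨rfl, update_le hle' ((hcle k hk).trans h.n_le), ?_, ?_⟩
    · intro a hab
      rw [Function.update_of_ne (by omega)]
      exact heq a hab
    · intro d hdk
      rcases Nat.lt_succ_iff_lt_or_eq.1 hdk with hdk | rfl
      · rw [Function.update_of_ne (by omega)]
        exact hd d hdk
      · rw [Function.update_self]
  · rintro mem' ⟨hle', heq, hd⟩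
    have hd : ∀ d < c, mem' d = cost (table n c m mem) c (m - 1) d := hd
    refine Tri.put (h.ok hm hle') (hQ _ ?_ ?_)
    · intro d hdc
      have : (Ex.var 1).eval (vars n c m) mem' = c := rfl
      rw [this, Function.update_of_ne (by omega)]
      exact hd d hdc
    · have : (Ex.var 1).eval (vars n c m) mem' = c := rfl
      rw [this, Function.update_self]
      exact foldUpTo_congr _ rfl fun k _ => hout mem' k heq

theorem tri_flood (h : Sizes n c N) (hG : G.Connected) (hN : numConnected G ≤ N) :
    Tri W (c * N) (vars n c N) floodStmt (vars n c 0) (inputState G ω).mem fun _ mem =>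
      (∀ d : Fin c, (mem d : ℕ∞) = minMovesTo G ω d) ∧ (mem c : ℕ∞) = minMoves G ω := by
  refine Tri.seq (tri_init h fun mem S hle hin hb hS => ?_)
  refine Tri.seq (tri_search h hN hle hin hb hS fun m mem S hle hin hb hS => ?_)
  have hm := hS.le_numConnected.trans hN
  refine Tri.seq (tri_inter h hm hle hin hb fun mem hle hin hb hI => ?_)
  refine Tri.seq (tri_table h hm hS hle hin hb hI fun mem hle hT => ?_)
  refine tri_out h hm (hS.pos hG) hle hT fun mem' hd hc => ⟨fun d => ?_, ?_⟩
  · rw [hd d d.2]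
    exact cost_eq_minMovesTo hG hS hT d
  · rw [hc]
    exact fold_cost_eq_minMoves hG hS hT

end Correctness

end FloodIt

/-! ### The algorithm and its bounds -/

theorem mainTheorem4 :
    ∃ (P : FloodIt.Prog) (K k : ℕ), ∀ (n c N : ℕ) (G : SimpleGraph (Fin n)) (ω : Fin n → Fin c),
      G.Connected → FloodIt.numConnected G ≤ N →
      ∃ (s : FloodIt.State) (t : ℕ),
        FloodIt.Exec (K * (c * N) ^ k) P (FloodIt.inputState G ω) s t ∧
        t ≤ K * (c ^ 3 * N ^ 3) ∧
        (∀ d : Fin c, (s.mem d : ℕ∞) = FloodIt.minMovesTo G ω d) ∧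
        (s.mem c : ℕ∞) = FloodIt.minMoves G ω := by
  -- One constant serves both bounds: `bd 1` for the size of numbers, `100000` for the running time.
  -- Scratch registers start at `10`, above all variables.
  refine ⟨FloodIt.floodStmt.compile 10, FloodIt.floodStmt.bd 1 + 100000, FloodIt.floodStmt.deg, ?_⟩
  intro n c N G ω hG hN
  obtain ⟨v⟩ := hG.nonempty
  have hsq := (FloodIt.sq_le_numConnected hG).trans (Nat.mul_le_mul_left 2 hN)
  have hn : 1 ≤ n := by have := v.2; omega
  have hc : 1 ≤ c := by have := (ω v).2; omega
  have h : FloodIt.Sizes n c N := ⟨hn, hc, by nlinarith⟩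
  have hW : FloodIt.floodStmt.bd (c * N) ≤
      (FloodIt.floodStmt.bd 1 + 100000) * (c * N) ^ FloodIt.floodStmt.deg :=
    (FloodIt.floodStmt.bd_le h.one_le).trans (Nat.mul_le_mul_right _ (Nat.le_add_right _ _))
  obtain ⟨s, τ, _, hex, hτ, -, -, hd, hmin⟩ := FloodIt.tri_flood (ω := ω) h hG hN
    FloodIt.floodStmt_wf hW 10 le_rfl (FloodIt.inputState G ω) (by
      intro r _
      simp only [FloodIt.inputState, FloodIt.vars]
      split_ifs <;> rfl) rfl
  refine ⟨s, τ, hex, hτ.trans ((FloodIt.floodStmt_time hn hc hsq).trans ?_), hd, hmin⟩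
  exact Nat.mul_le_mul_right _ (Nat.le_add_left _ _)
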